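/- Let $\mathbb T=\mathbb R/\mathbb Z$ with the wrap-around distance $d$, let $f_c\ge 128$ be an integer, and let $\varphi_k(x)=e^{2\pi i kx}$ for $k\in\{-f_c,\dots,f_c\}$. Let $\Delta=\sum_{j=1}^s\Delta_j e^{i\theta_j}\delta_{T_j}$ be a discrete complex measure on $\mathbb T$ with $\Delta_j>0$, $\theta_j\in\mathbb R$ and pairwise distinct $T_j\in\mathbb T$, whose support $\mathbf S=\{T_1,\dots,T_s\}$ satisfies $$\inf_{T,T'\in\mathbf S,\ T\ne T'}d(T,T')\ \ge\ \frac{2.5}{f_c}.$$ One observes $y_k=\int_{\mathbb T}\varphi_k\,d\Delta+\varepsilon_k$ for $|k|\le f_c$, where $\varepsilon_k=\varepsilon_k^{(1)}+i\,\varepsilon_k^{(2)}$ and the $2(2f_c+1)$ real random variables $\varepsilon_k^{(1)},\varepsilon_k^{(2)}$ are i.i.d. $\mathcal N(0,\sigma^2)$ with $\sigma>0$. Let $$\lambda\ \ge\ \lambda_F:=2\sigma\sqrt{6f_c\log f_c}.$$ Then, with probability at least $1-2\exp\left[-(\log f_c)\,\lambda^2/\lambda_F^2\right]$, every solution $\hat\Delta$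 of $$\min_{\mu}\ \frac12\sum_{|k|\le f_c}\Big|\int_{\mathbb T}\varphi_k\,d\mu-y_k\Big|^2+\lambda\|\mu\|_{TV},$$ the minimum being over all finite complex Borel measures $\mu$ on $\mathbb T$ and $\|\cdot\|_{TV}$ denoting the total variation norm, has the following two properties. 1. For every $x\in\mathbb T$ with $|\hat\Delta(\{x\})|\ge 218\lambda$ there is a unique $T\in\mathbf S$ with $$d(x,T)\le\Big[\frac{\lambda}{0.1678\,|\hat\Delta(\{x\})|}\Big]^{1/2}\frac1{f_c},$$ and this $T$ also satisfies $d(x,T)\le 0.1649/f_c$. 2. For every $j$ with $\Delta_j>218\lambda$ there is a point $\hat T$ in the support of $\hat\Delta$ with $$d(T_j,\hat T)\le\Big[\frac{\lambda}{0.1678\,(\Delta_j-218\lambda)}\Big]^{1/2}\frac1{f_c}.$$ -/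

import Mathlib

open MeasureTheory ProbabilityTheory
open scoped NNReal

namespace SpikeDetection

/-- The frequencies `-f_c, …, f_c`. -/
abbrev Freq (fc : ℕ) : Type := ↥(Finset.Icc (-(fc : ℤ)) (fc : ℤ))

/-- The Fourier sample `∫ exp(2π i k x) dμ(x)` of a complex Borel measure on the circle `ℝ/ℤ`;
the pairing of the integrand with the measure is the multiplication of `ℂ`. -/
noncomputable def fourierSample (μ : ComplexMeasure UnitAddCircle) (k : ℤ) : ℂ :=
  VectorMeasure.integral μ (fun x : UnitAddCircle => fourier k x) (ContinuousLinearMap.mul ℝ ℂ)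

/-- The total variation norm of a complex measure. -/
noncomputable def tvNorm (μ : ComplexMeasure UnitAddCircle) : ℝ :=
  (VectorMeasure.variation μ).real Set.univ

/-- The (closed) support of a complex measure, i.e. the support of its variation. -/
noncomputable def supp (μ : ComplexMeasure UnitAddCircle) : Set UnitAddCircle :=
  (VectorMeasure.variation μ).support

/-- The discrete measure `∑ⱼ aⱼ exp(i θⱼ) δ_{Tⱼ}`. -/
noncomputable def spikeTrain {s : ℕ} (a θ : Fin s → ℝ) (T : Fin s → UnitAddCircle) :
    ComplexMeasure UnitAddCircle :=
  ∑ j, VectorMeasure.dirac (T j) ((a j : ℂ) * Complex.exp (Complex.I * (θ j : ℂ)))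

/-- The objective `½ ‖∫ Φ dμ - y‖₂² + lam ‖μ‖_TV`. -/
noncomputable def blassoObjective (fc : ℕ) (lam : ℝ) (y : Freq fc → ℂ)
    (μ : ComplexMeasure UnitAddCircle) : ℝ :=
  (1 / 2 : ℝ) * ∑ k : Freq fc, ‖fourierSample μ k - y k‖ ^ 2 + lam * tvNorm μ

/-- `μ` minimizes the objective over all finite complex measures on the circle. -/
def IsBlassoSolution (fc : ℕ) (lam : ℝ) (y : Freq fc → ℂ)
    (μ : ComplexMeasure UnitAddCircle) : Prop :=
  IsMinOn (blassoObjective fc lam y) Set.univ μ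

/-- The threshold `λ_F = 2 σ √(6 f_c log f_c)`. -/
noncomputable def lambdaF (σ : ℝ) (fc : ℕ) : ℝ :=
  2 * σ * √(6 * (fc : ℝ) * Real.log fc)

end SpikeDetection

/-!
Let `p` be a trigonometric polynomial with coefficients in `-f_c, …, f_c`, values
`c j * exp (-i θ j)` at the spikes and `‖p‖ ≤ C`. Comparing the objective at a minimizer `μ` with
its value at the true measure `Δ`, and completing the square in the data fit, bounds
`‖μ‖_TV - ∫ ‖p‖ d|μ|` by `∑ j, a j * (1 - c j) + (δ + C)² lam / 2` as soon as the noise vector has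
Euclidean norm at most `δ lam`. A Chernoff bound gives `δ = 1/4` with the stated probability.

If all `c j` are `1` and `1 - ‖p‖` grows quadratically away from the spikes, every atom of `μ` pays
for its distance to the spikes: this is the first property. If instead `c j = 1 + b` for a single
`j`, and `μ` had no support near `T j`, the left-hand side would be nonnegative while the right-hand
side is about `(δ + 1)² lam / 2 - a j * b`: this is the second one.

The polynomial is the Hermite interpolant, with vanishing derivative at the spikes, built from
translates of the Fejér kernel and of its derivative. The separation of the spikes makes the
interpolation system diagonally dominant, once the kernel's decay is summed over the spikes ranked
by their distance to a point.
-/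

namespace SpikeDetection

open scoped Real

/-! ### The noise event -/

lemma mgf_sq_gaussianReal {v : ℝ≥0} {t : ℝ} (ht : 2 * v * t < 1) :
    mgf (fun x => x ^ 2) (gaussianReal 0 v) t = (√(1 - 2 * v * t))⁻¹ := by
  rcases eq_or_ne v 0 with rfl | hv
  · simp [mgf, gaussianReal_zero_var]
  have : (0 : ℝ) < v := by exact_mod_cast pos_iff_ne_zero.mpr hv
  have h_density (x : ℝ) : gaussianPDFReal 0 v x • Real.exp (t * x ^ 2)
      = (√(2 * π * v))⁻¹ * Real.exp (-((1 - 2 * v * t) / (2 * v)) * x ^ 2) := by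
    rw [gaussianPDFReal, smul_eq_mul, mul_assoc, ← Real.exp_add]
    congr 2
    field_simp
    ring
  have : 0 < 1 - 2 * v * t := by linarith
  simp_rw [mgf, integral_gaussianReal_eq_integral_smul hv, h_density]
  rw [integral_const_mul, integral_gaussian, ← Real.sqrt_inv, ← Real.sqrt_inv,
    ← Real.sqrt_mul (by positivity)]
  congr 1
  field_simp

lemma measureReal_sum_sq_ge_le {Ω ι : Type*} [MeasurableSpace Ω] [Fintype ι] {P : Measure Ω}
    {X : ι → Ω → ℝ} {v : ℝ≥0} (hX : ∀ i, HasLaw (X i) (gaussianReal 0 v) P)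
    (hindep : iIndepFun X P) {t : ℝ} (ht0 : 0 ≤ t) (ht : 2 * v * t < 1) (c : ℝ) :
    P.real {ω | c ≤ ∑ i, X i ω ^ 2}
      ≤ (√(1 - 2 * v * t))⁻¹ ^ Fintype.card ι * Real.exp (-t * c) := by
  have := hindep.isProbabilityMeasure
  have hmgf (i : ι) : mgf (fun ω => X i ω ^ 2) P t = (√(1 - 2 * v * t))⁻¹ := by
    rw [← mgf_sq_gaussianReal ht]
    exact (hX i).integral_comp (f := fun x => Real.exp (t * x ^ 2)) (by fun_prop)
  have hmgf_sum : mgf (fun ω => ∑ i, X i ω ^ 2) P t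
      = (√(1 - 2 * v * t))⁻¹ ^ Fintype.card ι := by
    have hindep_sq : iIndepFun (fun i ω => X i ω ^ 2) P :=
      hindep.comp (fun _ x => x ^ 2) fun _ => by fun_prop
    have h := hindep_sq.mgf_sum₀ (t := t) (fun i => (hX i).aemeasurable.pow_const 2) Finset.univ
    simpa only [Finset.sum_fn, hmgf, Finset.prod_const, Finset.card_univ] using h
  have : 0 < √(1 - 2 * v * t) := Real.sqrt_pos.mpr (by linarith)
  rw [← hmgf_sum, mul_comm]
  exact measure_ge_le_exp_mul_mgf c ht0 (mgf_pos_iff.mp (by rw [hmgf_sum]; positivity))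

lemma lambdaF_sq (σ : ℝ) (fc : ℕ) : lambdaF σ fc ^ 2 = 24 * σ ^ 2 * fc * Real.log fc := by
  have : 0 ≤ Real.log fc := Real.log_natCast_nonneg fc
  rw [lambdaF, mul_pow, Real.sq_sqrt (by positivity)]
  ring

lemma lambdaF_pos {σ : ℝ} (hσ : 0 < σ) {fc : ℕ} (hfc : 2 ≤ fc) : 0 < lambdaF σ fc := by
  have hfc' : (1 : ℝ) < fc := by exact_mod_cast hfc
  have : 0 < Real.log fc := Real.log_pos hfc'
  rw [lambdaF]
  positivity

lemma card_freq (fc : ℕ) : Fintype.card (Freq fc) = 2 * fc + 1 := by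
  rw [Fintype.card_coe, Int.card_Icc]
  omega

lemma exp_noise_tail_le {σ lam : ℝ} (hσ : 0 < σ) {fc : ℕ} (hfc : 128 ≤ fc)
    (hlam : lambdaF σ fc ≤ lam) :
    √2 ^ (2 * (2 * fc + 1)) * Real.exp (-(1 / (4 * σ ^ 2)) * (lam / 4) ^ 2)
      ≤ 2 * Real.exp (-(Real.log fc * (lam ^ 2 / lambdaF σ fc ^ 2))) := by
  have hfc' : (128 : ℝ) ≤ fc := by exact_mod_cast hfc
  have hF : 0 < lambdaF σ fc := lambdaF_pos hσ (by omega)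
  have hlog : 7 * Real.log 2 ≤ Real.log fc := by
    rw [← Real.log_rpow (by norm_num)]
    exact Real.log_le_log (by positivity) (by norm_num; exact hfc)
  have hlog2 : 0 < Real.log 2 := Real.log_pos (by norm_num)
  obtain ⟨r, hr⟩ : ∃ r, r = lam ^ 2 / lambdaF σ fc ^ 2 := ⟨_, rfl⟩
  have hr1 : 1 ≤ r := by
    rw [hr, one_le_div (by positivity)]
    gcongr
  have hlam_sq : lam ^ 2 = r * (24 * σ ^ 2 * fc * Real.log fc) := by
    rw [← lambdaF_sq, hr]
    field_simp
  have hsqrt : √2 ^ (2 * (2 * fc + 1)) = 2 * Real.exp (2 * fc * Real.log 2) := by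
    rw [pow_mul, Real.sq_sqrt (by norm_num), pow_succ, mul_comm, mul_comm (2 * (fc : ℝ)),
      Real.exp_mul, Real.exp_log (by norm_num)]
    norm_cast
  have hexponent : -(1 / (4 * σ ^ 2)) * (lam / 4) ^ 2 = -(3 / 8 * fc * (Real.log fc * r)) := by
    rw [div_pow, hlam_sq]
    field_simp
    ring
  rw [hsqrt, hexponent, ← hr, mul_assoc, ← Real.exp_add]
  have hlog_mul : 7 * Real.log 2 ≤ Real.log fc * r := by nlinarith
  gcongr
  nlinarith

lemma exists_noise_event {Ω : Type*} [MeasurableSpace Ω] (P : Measure Ω) {fc : ℕ}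
    (hfc : 128 ≤ fc) {σ : ℝ≥0} (hσ : 0 < σ) {ε₁ ε₂ : Freq fc → Ω → ℝ}
    (hε₁ : ∀ k, HasLaw (ε₁ k) (gaussianReal 0 (σ ^ 2)) P)
    (hε₂ : ∀ k, HasLaw (ε₂ k) (gaussianReal 0 (σ ^ 2)) P)
    (hindep : iIndepFun (Sum.elim ε₁ ε₂) P) {lam : ℝ} (hlam : lambdaF σ fc ≤ lam) :
    ∃ A : Set Ω, MeasurableSet A ∧
      1 - 2 * Real.exp (-(Real.log fc * (lam ^ 2 / lambdaF σ fc ^ 2))) ≤ P.real A ∧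
      ∀ ω ∈ A, ∑ k, ‖(ε₁ k ω : ℂ) + Complex.I * (ε₂ k ω : ℂ)‖ ^ 2 ≤ (lam / 4) ^ 2 := by
  have := hindep.isProbabilityMeasure
  have hσ' : (0 : ℝ) < σ := hσ
  let B : Set Ω := {ω | (lam / 4) ^ 2 ≤ ∑ i, Sum.elim ε₁ ε₂ i ω ^ 2}
  have hlaw : ∀ i, HasLaw (Sum.elim ε₁ ε₂ i) (gaussianReal 0 (σ ^ 2)) P := Sum.rec hε₁ hε₂
  have hhalf : 2 * ((σ ^ 2 : ℝ≥0) : ℝ) * (1 / (4 * σ ^ 2)) = 1 / 2 := by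
    push_cast
    field_simp
    norm_num
  have htail : P.real B ≤ 2 * Real.exp (-(Real.log fc * (lam ^ 2 / lambdaF σ fc ^ 2))) := by
    have hchernoff := measureReal_sum_sq_ge_le hlaw hindep (t := 1 / (4 * σ ^ 2)) (by positivity)
      (by rw [hhalf]; norm_num) ((lam / 4) ^ 2)
    rw [hhalf, Fintype.card_sum, card_freq, ← two_mul, ← Real.sqrt_inv,
      show ((1 : ℝ) - 1 / 2)⁻¹ = 2 by norm_num] at hchernoff
    exact hchernoff.trans (exp_noise_tail_le hσ' hfc hlam)
  refine ⟨(toMeasurable P B)ᶜ, (measurableSet_toMeasurable P B).compl, ?_, fun ω hω => ?_⟩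
  · rw [probReal_compl_eq_one_sub (measurableSet_toMeasurable P B), measureReal_def,
      measure_toMeasurable, ← measureReal_def]
    linarith
  · have hωB : ω ∉ B := fun h => hω (subset_toMeasurable P B h)
    simp only [B, Set.mem_ofPred_eq, not_le, Fintype.sum_sum_type, Sum.elim_inl, Sum.elim_inr,
      ← Finset.sum_add_distrib] at hωB
    refine le_trans (le_of_eq (Finset.sum_congr rfl fun k _ => ?_)) hωB.le
    rw [← Complex.normSq_eq_norm_sq, mul_comm, Complex.normSq_add_mul_I]

/-! ### Trigonometric polynomials and the Bregman bound -/

instance isFiniteMeasure_variation {X : Type*} [MeasurableSpace X] (μ : ComplexMeasure X) :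
    IsFiniteMeasure μ.variation := by
  have h_le : μ.variation ≤
      (ComplexMeasure.re μ).totalVariation + (ComplexMeasure.im μ).totalVariation := by
    refine VectorMeasure.variation_le_of_forall_enorm_le fun E _ => ?_
    calc ‖μ E‖ₑ
        = ‖((ComplexMeasure.re μ E : ℝ) : ℂ) + ((ComplexMeasure.im μ E : ℝ) : ℂ) * Complex.I‖ₑ :=
          congrArg _ (Complex.re_add_im (μ E)).symm
      _ ≤ ‖ComplexMeasure.re μ E‖ₑ + ‖ComplexMeasure.im μ E‖ₑ :=
          (enorm_add_le _ _).trans_eq (by simp [← ofReal_norm])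
      _ ≤ _ := add_le_add ((ComplexMeasure.re μ).enorm_le_totalVariation E)
          ((ComplexMeasure.im μ).enorm_le_totalVariation E)
  exact isFiniteMeasure_of_le _ h_le

lemma one_sub_norm_mul_norm_singleton_le {X E : Type*} [MeasurableSpace X]
    [MeasurableSingletonClass X] [NormedAddCommGroup E] (μ : ComplexMeasure X) {f : X → E}
    (hfm : AEStronglyMeasurable f μ.variation) (hf : ∀ x, ‖f x‖ ≤ 1) (x : X) :
    (1 - ‖f x‖) * ‖μ {x}‖ ≤ μ.variation.real Set.univ - ∫ y, ‖f y‖ ∂μ.variation := by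
  have hint : Integrable (fun y => ‖f y‖) μ.variation :=
    (Integrable.of_bound hfm 1 (ae_of_all _ hf)).norm
  calc (1 - ‖f x‖) * ‖μ {x}‖
      ≤ (1 - ‖f x‖) * μ.variation.real {x} :=
        mul_le_mul_of_nonneg_left VectorMeasure.norm_measure_le_variation
          (sub_nonneg.mpr (hf x))
    _ = ∫ y in {x}, (1 - ‖f y‖) ∂μ.variation := by
        rw [integral_singleton, smul_eq_mul, mul_comm]
    _ ≤ ∫ y, (1 - ‖f y‖) ∂μ.variation :=
        setIntegral_le_integral ((integrable_const _).sub hint)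
          (ae_of_all _ fun y => sub_nonneg.mpr (hf y))
    _ = _ := by
        rw [integral_sub (integrable_const _) hint, integral_const, smul_eq_mul, mul_one]

lemma integral_norm_le_measureReal_univ {X E : Type*} [TopologicalSpace X]
    [HereditarilyLindelofSpace X] [MeasurableSpace X] [NormedAddCommGroup E] {ν : Measure X}
    [IsFiniteMeasure ν] {f : X → E} (hf : ∀ x ∈ ν.support, ‖f x‖ ≤ 1) :
    ∫ x, ‖f x‖ ∂ν ≤ ν.real Set.univ := by
  have h : ∫ x, ‖f x‖ ∂ν ≤ ∫ _, (1 : ℝ) ∂ν :=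
    integral_mono_of_nonneg (ae_of_all _ fun x => norm_nonneg (f x)) (integrable_const 1)
      (Filter.mem_of_superset Measure.support_mem_ae hf)
  simpa only [integral_const, smul_eq_mul, mul_one] using h

lemma sum_norm_sub_sq_le {ι E : Type*} [Fintype ι] [SeminormedAddCommGroup E] {u v : ι → E}
    {A B : ℝ} (hA : 0 ≤ A) (hB : 0 ≤ B) (hu : ∑ k, ‖u k‖ ^ 2 ≤ A ^ 2)
    (hv : ∑ k, ‖v k‖ ^ 2 ≤ B ^ 2) : ∑ k, ‖u k - v k‖ ^ 2 ≤ (A + B) ^ 2 := by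
  have norm_toLp_sq (w : ι → E) : ∑ k, ‖w k‖ ^ 2 = ‖WithLp.toLp 2 w‖ ^ 2 :=
    (PiLp.norm_sq_eq_of_L2 _ (WithLp.toLp 2 w)).symm
  rw [norm_toLp_sq] at hu hv
  rw [norm_toLp_sq fun k => u k - v k]
  gcongr
  exact (norm_sub_le (WithLp.toLp 2 u) (WithLp.toLp 2 v)).trans
    (add_le_add (le_of_sq_le_sq hu hA) (le_of_sq_le_sq hv hB))

/-- The trigonometric polynomial `∑ k, p k • exp(2π i k ·)` as a continuous function on the circle;
it is the adjoint of the Fourier sampling map. -/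
noncomputable def trigPoly {fc : ℕ} (p : Freq fc → ℂ) : C(UnitAddCircle, ℂ) :=
  ∑ k, p k • fourier (k : ℤ)

section TrigPoly

variable {fc : ℕ} (p : Freq fc → ℂ)

lemma trigPoly_apply (x : UnitAddCircle) : trigPoly p x = ∑ k, p k * fourier (k : ℤ) x := by
  simp only [trigPoly, ContinuousMap.coe_sum, Finset.sum_apply, ContinuousMap.coe_smul,
    Pi.smul_apply, smul_eq_mul]

lemma integrable_continuousMap (μ : ComplexMeasure UnitAddCircle) (f : C(UnitAddCircle, ℂ)) :
    VectorMeasure.Integrable μ (f : UnitAddCircle → ℂ) :=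
  f.continuous.integrable_of_hasCompactSupport (HasCompactSupport.of_compactSpace _)

lemma sum_mul_fourierSample (μ : ComplexMeasure UnitAddCircle) :
    ∑ k, p k * fourierSample μ k =
      VectorMeasure.integral μ (trigPoly p) (ContinuousLinearMap.mul ℝ ℂ) := by
  have h_sum : (trigPoly p : UnitAddCircle → ℂ) = fun x => ∑ k, (p k • fourier (k : ℤ)) x := by
    funext x
    rw [trigPoly, ContinuousMap.sum_apply]
  have h_smul (c : ℂ) (f : UnitAddCircle → ℂ) :
      VectorMeasure.integral μ (c • f) (ContinuousLinearMap.mul ℝ ℂ)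
        = c * VectorMeasure.integral μ f (ContinuousLinearMap.mul ℝ ℂ) :=
    setToFun_smul _ (fun c s x => by
      simp only [VectorMeasure.transpose, ContinuousLinearMap.flip_mul,
        VectorMeasure.mapRange_apply, LinearMap.toAddMonoidHom_coe, ContinuousLinearMap.coe_coe,
        smul_eq_mul, ContinuousLinearMap.mul_apply']
      ring) c f
  rw [h_sum, VectorMeasure.integral_finsetSum _ fun k _ => integrable_continuousMap μ _]
  exact Finset.sum_congr rfl fun k _ => (h_smul (p k) _).symm

lemma norm_sum_mul_fourierSample_le (μ : ComplexMeasure UnitAddCircle) :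
    ‖∑ k, p k * fourierSample μ k‖ ≤ ∫ x, ‖trigPoly p x‖ ∂μ.variation := by
  rw [sum_mul_fourierSample]
  refine VectorMeasure.norm_integral_le_integral_norm.trans_eq ?_
  rw [ContinuousLinearMap.opNorm_mul, one_mul]

lemma sum_mul_fourierSample_spikeTrain {s : ℕ} (a θ : Fin s → ℝ) (T : Fin s → UnitAddCircle) :
    ∑ k, p k * fourierSample (spikeTrain a θ T) k =
      ∑ j, trigPoly p (T j) * ((a j : ℂ) * Complex.exp (Complex.I * (θ j : ℂ))) := by
  rw [sum_mul_fourierSample, spikeTrain, VectorMeasure.integral_finsetSum_vectorMeasure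
    fun j _ => integrable_continuousMap _ _]
  simp only [VectorMeasure.integral_dirac, ContinuousLinearMap.mul_apply']

variable {p}

/-- Parseval's identity compares the coefficients with the `L²` norm, hence with the supremum. -/
lemma sum_norm_sq_le_of_norm_trigPoly_le {C : ℝ} (hC : 0 ≤ C) (hp : ∀ x, ‖trigPoly p x‖ ≤ C) :
    ∑ k, ‖p k‖ ^ 2 ≤ C ^ 2 := by
  have horth : Orthonormal ℂ (fun k : Freq fc => fourierLp (T := 1) 2 (k : ℤ)) :=
    orthonormal_fourier.comp _ Subtype.val_injective
  have hparseval : ‖∑ k, p k • fourierLp (T := 1) 2 ((k : Freq fc) : ℤ)‖ ^ 2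
      = ∑ k, ‖p k‖ ^ 2 := by
    rw [← inner_self_eq_norm_sq (𝕜 := ℂ), horth.inner_sum]
    simp [← Complex.normSq_eq_conj_mul_self, Complex.normSq_eq_norm_sq, -Complex.ofReal_pow]
  have htoLp : ∑ k, p k • fourierLp (T := 1) 2 ((k : Freq fc) : ℤ)
      = ContinuousMap.toLp (E := ℂ) 2 AddCircle.haarAddCircle ℂ (trigPoly p) := by
    simp only [trigPoly, map_sum, map_smul, fourierLp]
  have hnorm_toLp := ContinuousMap.toLp_norm_le (p := 2)
    (μ := AddCircle.haarAddCircle (T := (1 : ℝ))) (E := ℂ) (𝕜 := ℂ)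
  simp only [measureUnivNNReal, measure_univ, ENNReal.toNNReal_one, NNReal.coe_one,
    Real.one_rpow] at hnorm_toLp
  rw [← hparseval, htoLp]
  gcongr
  calc _ ≤ 1 * ‖trigPoly p‖ := ContinuousLinearMap.le_of_opNorm_le _ hnorm_toLp _
    _ ≤ C := by rw [one_mul]; exact (ContinuousMap.norm_le _ hC).2 hp

end TrigPoly

lemma tvNorm_spikeTrain_le {s : ℕ} {a : Fin s → ℝ} (ha : ∀ j, 0 ≤ a j) (θ : Fin s → ℝ)
    (T : Fin s → UnitAddCircle) : tvNorm (spikeTrain a θ T) ≤ ∑ j, a j := by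
  have hmass (j : Fin s) :
      ‖(a j : ℂ) * Complex.exp (Complex.I * (θ j : ℂ))‖ₑ = ENNReal.ofReal (a j) := by
    rw [← ofReal_norm, norm_mul, mul_comm Complex.I, Complex.norm_exp_ofReal_mul_I, mul_one,
      Complex.norm_real, Real.norm_of_nonneg (ha j)]
  have hsum := VectorMeasure.variation_finsetSum_le Finset.univ (fun j =>
    VectorMeasure.dirac (T j) ((a j : ℂ) * Complex.exp (Complex.I * (θ j : ℂ)))) Set.univ
  simp only [VectorMeasure.variation_dirac, hmass, Measure.coe_finsetSum, Finset.sum_apply,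
    Measure.smul_apply, measure_univ, smul_eq_mul, mul_one] at hsum
  rw [← ENNReal.ofReal_sum_of_nonneg fun j _ => ha j] at hsum
  exact ENNReal.toReal_le_of_le_ofReal (Finset.sum_nonneg fun j _ => ha j) hsum

lemma completing_square_le (e d q : ℂ) (r : ℝ) :
    1 / 2 * ‖e‖ ^ 2 - 1 / 2 * ‖d - e‖ ^ 2 - r * (q * d).re
      ≤ 1 / 2 * ‖(starRingEnd ℂ) e - r * q‖ ^ 2 := by
  simp only [← Complex.normSq_eq_norm_sq, Complex.normSq_apply, Complex.sub_re, Complex.sub_im,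
    Complex.mul_re, Complex.mul_im, Complex.conj_re, Complex.conj_im, Complex.ofReal_re,
    Complex.ofReal_im]
  nlinarith [sq_nonneg (d.re - e.re + r * q.re), sq_nonneg (d.im - e.im - r * q.im)]

section Bregman

variable {fc : ℕ} {lam δ C : ℝ} {ε p : Freq fc → ℂ} {μ Δ : ComplexMeasure UnitAddCircle}

/-- Completing the square leaves `½ ∑ ‖conj ε - lam p‖²`, which Minkowski and Parseval bound. -/
lemma data_fit_sub_le (hlam : 0 ≤ lam) (hδ : 0 ≤ δ) (hε : ∑ k, ‖ε k‖ ^ 2 ≤ (δ * lam) ^ 2)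
    (hC : 0 ≤ C) (hp : ∀ x, ‖trigPoly p x‖ ≤ C) (d : Freq fc → ℂ) :
    1 / 2 * ∑ k, ‖ε k‖ ^ 2 - 1 / 2 * ∑ k, ‖d k - ε k‖ ^ 2 - lam * (∑ k, p k * d k).re
      ≤ lam * (1 / 2 * (δ + C) ^ 2 * lam) := by
  have hlam_p : ∑ k, ‖(lam : ℂ) * p k‖ ^ 2 ≤ (C * lam) ^ 2 := by
    simp only [norm_mul, mul_pow, Complex.norm_real, Real.norm_eq_abs, sq_abs, ← Finset.mul_sum]
    rw [mul_comm]
    gcongr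
    exact sum_norm_sq_le_of_norm_trigPoly_le hC hp
  calc 1 / 2 * ∑ k, ‖ε k‖ ^ 2 - 1 / 2 * ∑ k, ‖d k - ε k‖ ^ 2 - lam * (∑ k, p k * d k).re
      ≤ 1 / 2 * ∑ k, ‖(starRingEnd ℂ) (ε k) - lam * p k‖ ^ 2 := by
        rw [Complex.re_sum, Finset.mul_sum, Finset.mul_sum, Finset.mul_sum, Finset.mul_sum,
          ← Finset.sum_sub_distrib, ← Finset.sum_sub_distrib]
        exact Finset.sum_le_sum fun k _ => completing_square_le _ _ _ _
    _ ≤ 1 / 2 * (δ * lam + C * lam) ^ 2 := by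
        gcongr
        exact sum_norm_sub_sq_le (by positivity) (by positivity)
          (by simpa only [RCLike.norm_conj] using hε) hlam_p
    _ = lam * (1 / 2 * (δ + C) ^ 2 * lam) := by ring

lemma tvNorm_sub_integral_norm_le (hlam : 0 < lam) (hδ : 0 ≤ δ)
    (hε : ∑ k, ‖ε k‖ ^ 2 ≤ (δ * lam) ^ 2)
    (hμ : IsBlassoSolution fc lam (fun k => fourierSample Δ k + ε k) μ)
    (hC : 0 ≤ C) (hp : ∀ x, ‖trigPoly p x‖ ≤ C) :
    tvNorm μ - ∫ x, ‖trigPoly p x‖ ∂μ.variation ≤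
      tvNorm Δ - (∑ k, p k * fourierSample Δ k).re + 1 / 2 * (δ + C) ^ 2 * lam := by
  have hmin : blassoObjective fc lam _ μ ≤ blassoObjective fc lam _ Δ := hμ (Set.mem_univ Δ)
  simp only [blassoObjective, sub_add_cancel_left, norm_neg, ← sub_sub] at hmin
  have hfit := data_fit_sub_le hlam.le hδ hε hC hp fun k => fourierSample μ k - fourierSample Δ k
  simp only [mul_sub, Finset.sum_sub_distrib, Complex.sub_re] at hfit
  have hdual := (Complex.re_le_norm _).trans (norm_sum_mul_fourierSample_le p μ)
  have h_scaled : lam * (tvNorm μ - (∑ k, p k * fourierSample μ k).re)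
      ≤ lam * (tvNorm Δ - (∑ k, p k * fourierSample Δ k).re + 1 / 2 * (δ + C) ^ 2 * lam) := by
    linarith
  linarith [le_of_mul_le_mul_left h_scaled hlam]

end Bregman

/-! ### The Fejér kernel and its moments -/

lemma sum_triangle_eq_of_succ {R : Type*} [CommRing R] {f : ℤ → R} {D F : ℕ → R}
    (hD0 : D 0 = f 0) (hD : ∀ n : ℕ, D (n + 1) = D n + (f (n + 1) + f (-(n + 1))))
    (hF0 : F 0 = f 0) (hF : ∀ n, F (n + 1) = F n + D (n + 1)) (n : ℕ) :
    ∑ k ∈ Finset.Icc (-(n : ℤ)) n, ((n : R) + 1 - (|k| : ℤ)) * f k = F n := by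
  have hsum (n : ℕ) : ∑ k ∈ Finset.Icc (-(n : ℤ)) n, f k = D n := by
    induction n with
    | zero => simp [hD0]
    | succ n ih =>
      push_cast
      rw [Finset.sum_Icc_succ_eq_add_endpoints, ih, hD, add_comm]
  induction n with
  | zero => simp [hF0]
  | succ n ih =>
    have habs : |(n : ℤ) + 1| = n + 1 := abs_of_nonneg (by positivity)
    have hsplit (k : ℤ) : ((n : R) + 1 + 1 - (|k| : ℤ)) * f k
        = ((n : R) + 1 - (|k| : ℤ)) * f k + f k := by ring
    have hvanish : ∑ k ∈ Finset.Icc (-((n : ℤ) + 1)) (n + 1), ((n : R) + 1 - (|k| : ℤ)) * f k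
        = F n := by
      rw [Finset.sum_Icc_succ_eq_add_endpoints, ih, abs_neg, habs]
      push_cast
      ring
    push_cast
    simp_rw [hsplit]
    rw [Finset.sum_add_distrib, hvanish, hF, ← hsum (n + 1)]
    push_cast
    rfl

lemma sum_triangle_mul_exp_mul_sin_sq (n : ℕ) (y : ℂ) :
    (∑ k ∈ Finset.Icc (-(n : ℤ)) n, ((n : ℂ) + 1 - (|k| : ℤ)) * Complex.exp (2 * k * y * Complex.I))
      * Complex.sin y ^ 2 = Complex.sin ((n + 1) * y) ^ 2 := by
  have h_exp_add (n : ℕ) : Complex.exp (2 * ((n + 1 : ℤ) : ℂ) * y * Complex.I)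
      + Complex.exp (2 * ((-(n + 1) : ℤ) : ℂ) * y * Complex.I)
      = 2 * Complex.cos (2 * (n + 1) * y) := by
    rw [Complex.two_cos]
    push_cast
    ring_nf
  have h_dirichlet (n : ℕ) : 2 * Complex.cos (2 * (n + 1) * y) * Complex.sin y
      = Complex.sin ((2 * (n + 1) + 1) * y) - Complex.sin ((2 * n + 1) * y) := by
    rw [show (2 * ((n : ℂ) + 1) + 1) * y = 2 * (n + 1) * y + y by ring,
      show (2 * (n : ℂ) + 1) * y = 2 * (n + 1) * y - y by ring, Complex.sin_add, Complex.sin_sub]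
    ring
  have h_fejer (n : ℕ) : Complex.sin ((n + 1 + 1) * y) ^ 2 - Complex.sin ((n + 1) * y) ^ 2
      = Complex.sin ((2 * (n + 1) + 1) * y) * Complex.sin y := by
    rw [show ((n : ℂ) + 1 + 1) * y = (n + 1) * y + y by ring,
      show (2 * ((n : ℂ) + 1) + 1) * y = 2 * ((n + 1) * y) + y by ring, Complex.sin_add,
      Complex.sin_add, Complex.sin_two_mul, Complex.cos_two_mul]
    linear_combination Complex.sin ((n + 1) * y) ^ 2 * Complex.sin_sq_add_cos_sq y
      - Complex.sin y ^ 2 * Complex.sin_sq_add_cos_sq ((n + 1) * y)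
  rw [Finset.sum_mul]
  simp_rw [mul_assoc _ (Complex.exp _)]
  refine sum_triangle_eq_of_succ
    (f := fun k => Complex.exp (2 * k * y * Complex.I) * Complex.sin y ^ 2)
    (D := fun n => Complex.sin ((2 * n + 1) * y) * Complex.sin y)
    (F := fun n => Complex.sin ((n + 1) * y) ^ 2) (by simp [sq]) (fun n => ?_) (by simp)
    (fun n => ?_) n
  · rw [← add_mul, h_exp_add]
    push_cast
    linear_combination -Complex.sin y * h_dirichlet n
  · push_cast
    linear_combination h_fejer n

/-- The Fourier coefficients `(1 - |k| / (N + 1)) / (N + 1)` of the Fejér kernel, normalized so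
that the kernel takes the value `1` at the origin. -/
noncomputable def fejerCoeff (N : ℕ) (k : ℤ) : ℝ :=
  ((N : ℝ) + 1 - (|k| : ℤ)) / (N + 1) ^ 2

lemma fejerCoeff_nonneg {N : ℕ} {k : ℤ} (hk : k ∈ Finset.Icc (-(N : ℤ)) N) :
    0 ≤ fejerCoeff N k := by
  have hk' : ((|k| : ℤ) : ℝ) ≤ N := by exact_mod_cast abs_le.mpr (Finset.mem_Icc.mp hk)
  exact div_nonneg (by linarith) (by positivity)

/-- The moments of the Fejér coefficients for the frequencies `2 |k| / (N + 1)`; they bound the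
derivatives of the Fejér kernel. -/
noncomputable def fejerMoment (N n : ℕ) : ℝ :=
  ∑ k ∈ Finset.Icc (-(N : ℤ)) N, fejerCoeff N k * (2 * (|k| : ℤ) / (N + 1)) ^ n

lemma fejerMoment_eq_of_succ {p : ℕ} {D F : ℕ → ℝ} (hD0 : D 0 = 0 ^ p)
    (hD : ∀ n : ℕ, D (n + 1) = D n + 2 * ((n : ℝ) + 1) ^ p) (hF0 : F 0 = 0 ^ p)
    (hF : ∀ n, F (n + 1) = F n + D (n + 1)) (N : ℕ) :
    fejerMoment N p = 2 ^ p / ((N : ℝ) + 1) ^ (p + 2) * F N := by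
  have habs (n : ℕ) : |(n : ℤ) + 1| = n + 1 := abs_of_nonneg (by positivity)
  rw [← sum_triangle_eq_of_succ (f := fun k => ((|k| : ℤ) : ℝ) ^ p) (by simp [hD0])
    (fun n => by rw [hD, abs_neg, habs]; push_cast; ring) (by simp [hF0]) hF N,
    fejerMoment, Finset.mul_sum]
  refine Finset.sum_congr rfl fun k _ => ?_
  rw [fejerCoeff, div_pow, mul_pow, pow_add]
  field_simp

section Moments

variable (N : ℕ)

lemma fejerMoment_zero : fejerMoment N 0 = 1 := by
  rw [fejerMoment_eq_of_succ (D := fun n => 2 * n + 1) (F := fun n => ((n : ℝ) + 1) ^ 2) (by simp)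
    (fun n => by push_cast; ring) (by simp) (fun n => by push_cast; ring)]
  field_simp

lemma fejerMoment_one : fejerMoment N 1 = 2 / 3 * (1 - 1 / (N + 1) ^ 2) := by
  rw [fejerMoment_eq_of_succ (D := fun n => (n : ℝ) * (n + 1))
    (F := fun n => ((n : ℝ) + 1) * (((n : ℝ) + 1) ^ 2 - 1) / 3) (by simp)
    (fun n => by push_cast; ring) (by simp) (fun n => by push_cast; ring)]
  field_simp

lemma fejerMoment_two : fejerMoment N 2 = 2 / 3 * (1 - 1 / (N + 1) ^ 2) := by
  rw [fejerMoment_eq_of_succ (D := fun n => (n : ℝ) * (n + 1) * (2 * n + 1) / 3)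
    (F := fun n => ((n : ℝ) + 1) ^ 2 * (((n : ℝ) + 1) ^ 2 - 1) / 6) (by simp)
    (fun n => by push_cast; ring) (by simp) (fun n => by push_cast; ring)]
  field_simp
  ring

lemma fejerMoment_three :
    fejerMoment N 3
      = 4 * (((N : ℝ) + 1) ^ 2 - 1) * (3 * (N + 1) ^ 2 - 2) / (15 * (N + 1) ^ 4) := by
  rw [fejerMoment_eq_of_succ (D := fun n => ((n : ℝ) * (n + 1)) ^ 2 / 2)
    (F := fun n => ((n : ℝ) + 1) * (((n : ℝ) + 1) ^ 2 - 1) * (3 * ((n : ℝ) + 1) ^ 2 - 2) / 30)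
    (by simp) (fun n => by push_cast; ring) (by simp) (fun n => by push_cast; ring)]
  field_simp
  ring

lemma fejerMoment_four :
    fejerMoment N 4
      = 8 * (((N : ℝ) + 1) ^ 2 - 1) * (2 * (N + 1) ^ 2 - 3) / (15 * (N + 1) ^ 4) := by
  rw [fejerMoment_eq_of_succ
    (D := fun n => (n : ℝ) * (n + 1) * (2 * n + 1) * (3 * n ^ 2 + 3 * n - 1) / 15)
    (F := fun n => ((n : ℝ) + 1) ^ 2 * (((n : ℝ) + 1) ^ 2 - 1) * (2 * ((n : ℝ) + 1) ^ 2 - 3) / 30)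
    (by simp) (fun n => by push_cast; ring) (by simp) (fun n => by push_cast; ring)]
  field_simp
  ring

lemma fejerMoment_one_le : fejerMoment N 1 ≤ 2 / 3 := by
  have : 0 ≤ 1 / ((N : ℝ) + 1) ^ 2 := by positivity
  rw [fejerMoment_one]
  linarith

lemma fejerMoment_two_le : fejerMoment N 2 ≤ 2 / 3 := by
  have : 0 ≤ 1 / ((N : ℝ) + 1) ^ 2 := by positivity
  rw [fejerMoment_two]
  linarith

lemma le_fejerMoment_two {N : ℕ} (hN : 128 ≤ N) : 0.6666 ≤ fejerMoment N 2 := by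
  have hN' : (129 : ℝ) ≤ N + 1 := by exact_mod_cast Nat.succ_le_succ hN
  have : 1 / ((N : ℝ) + 1) ^ 2 ≤ 1 / 129 ^ 2 := by gcongr
  rw [fejerMoment_two]
  linarith

lemma fejerMoment_three_le : fejerMoment N 3 ≤ 4 / 5 := by
  rw [fejerMoment_three, div_le_iff₀ (by positivity)]
  nlinarith [sq_nonneg (N : ℝ), N.cast_nonneg (α := ℝ)]

lemma fejerMoment_four_le : fejerMoment N 4 ≤ 16 / 15 := by
  rw [fejerMoment_four, div_le_iff₀ (by positivity)]
  nlinarith [sq_nonneg (N : ℝ), N.cast_nonneg (α := ℝ)]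

end Moments

/-- The point `u / (π (N + 1))` of the circle. In the variable `u` the Fejér kernel of degree `N`
is close to `(sin u / u) ^ 2`, uniformly in `N`. -/
noncomputable def dilate (N : ℕ) (u : ℝ) : UnitAddCircle :=
  ((u / (π * (N + 1)) : ℝ) : UnitAddCircle)

section Kernel

variable (N n : ℕ)

lemma dilate_zero : dilate N 0 = 0 := by
  rw [dilate, zero_div, QuotientAddGroup.mk_zero]

lemma dilate_eq_zero_of_sin_eq_zero {N : ℕ} {u : ℝ} (hu : Real.sin (u / (N + 1)) = 0) :
    dilate N u = 0 := by
  obtain ⟨n, hn⟩ := Real.sin_eq_zero_iff.mp hu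
  refine (AddCircle.coe_eq_zero_iff _).mpr ⟨n, ?_⟩
  rw [mul_comm π, ← div_div, ← hn, mul_div_cancel_right₀ _ Real.pi_ne_zero, zsmul_one]

lemma exists_dilate_eq (x : UnitAddCircle) : ∃ u, dilate N u = x ∧ |u| = π * (N + 1) * ‖x‖ := by
  induction x using QuotientAddGroup.induction_on with | _ t
  refine ⟨π * (N + 1) * (t - round t), ?_, ?_⟩
  · rw [dilate, mul_div_cancel_left₀ _ (by positivity), AddCircle.coe_sub, sub_eq_self]
    exact AddCircle.coe_eq_zero_iff _ |>.mpr ⟨round t, by simp⟩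
  · rw [abs_mul, abs_of_pos (by positivity), UnitAddCircle.norm_eq]

lemma norm_dilate_le (u : ℝ) : π * (N + 1) * ‖dilate N u‖ ≤ |u| := by
  have h : ‖dilate N u‖ ≤ |u / (π * (N + 1))| := QuotientAddGroup.norm_mk_le_norm
  rwa [abs_div, abs_of_pos (by positivity : 0 < π * (N + 1)), le_div_iff₀ (by positivity),
    mul_comm] at h

lemma fourier_dilate (k : ℤ) (u : ℝ) :
    fourier k (dilate N u) = Complex.exp (2 * Complex.I * k / (N + 1) * u) := by
  have hπ : (π : ℂ) ≠ 0 := by exact_mod_cast Real.pi_ne_zero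
  have hN : (N : ℂ) + 1 ≠ 0 := by exact_mod_cast N.succ_ne_zero
  rw [dilate, fourier_coe_apply]
  congr 1
  push_cast
  field_simp

/-- The `n`-th derivative of the Fejér kernel of degree `N` along `dilate N`. -/
noncomputable def fejerKernel (x : UnitAddCircle) : ℂ :=
  ∑ k ∈ Finset.Icc (-(N : ℤ)) N,
    (fejerCoeff N k : ℂ) * (2 * Complex.I * k / (N + 1)) ^ n * fourier k x

lemma norm_fejerKernel_le (x : UnitAddCircle) : ‖fejerKernel N n x‖ ≤ fejerMoment N n := by
  refine norm_sum_le_of_le _ fun k hk => le_of_eq ?_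
  have hfourier : ‖fourier k x‖ = 1 := Circle.norm_coe _
  have hN : ‖(N : ℂ) + 1‖ = N + 1 := by exact_mod_cast Complex.norm_natCast (N + 1)
  rw [norm_mul, norm_mul, hfourier, mul_one, norm_pow, norm_div, norm_mul, norm_mul, hN,
    Complex.norm_real, Real.norm_of_nonneg (fejerCoeff_nonneg hk), Complex.norm_I,
    Complex.norm_ofNat, mul_one, Complex.norm_intCast, Int.cast_abs]

lemma hasDerivAt_fejerKernel_add_dilate (x : UnitAddCircle) (u : ℝ) :
    HasDerivAt (fun u => fejerKernel N n (x + dilate N u))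
      (fejerKernel N (n + 1) (x + dilate N u)) u := by
  refine HasDerivAt.fun_sum fun k _ => ?_
  set ω : ℂ := 2 * Complex.I * k / (N + 1)
  have hfourier (u : ℝ) : fourier k (x + dilate N u) = fourier k x * Complex.exp (ω * u) := by
    rw [← fourier_dilate]
    simp [fourier_apply, smul_add, AddCircle.toCircle_add]
  have hexp : HasDerivAt (fun u : ℝ => Complex.exp (ω * u)) (Complex.exp (ω * u) * ω) u := by
    simpa only [mul_one, id_eq] using ((hasDerivAt_id (u : ℂ)).const_mul ω).cexp.comp_ofReal
  simp only [hfourier]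
  convert! (hexp.const_mul (fourier k x)).const_mul ((fejerCoeff N k : ℂ) * ω ^ n) using 1
  ring

lemma hasDerivAt_fejerKernel_dilate (u : ℝ) :
    HasDerivAt (fun u => fejerKernel N n (dilate N u)) (fejerKernel N (n + 1) (dilate N u)) u := by
  simpa only [zero_add] using hasDerivAt_fejerKernel_add_dilate N n 0 u

lemma fejerKernel_zero_dilate_mul_sin_sq (u : ℝ) :
    fejerKernel N 0 (dilate N u) * (Real.sin (u / (N + 1)) ^ 2 : ℝ)
      = (Real.sin u ^ 2 / (N + 1) ^ 2 : ℝ) := by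
  have hN : (N : ℂ) + 1 ≠ 0 := by exact_mod_cast N.succ_ne_zero
  have h := sum_triangle_mul_exp_mul_sin_sq N (u / (N + 1))
  rw [mul_div_cancel₀ _ hN] at h
  rw [Complex.ofReal_div, Complex.ofReal_pow, Complex.ofReal_pow, Complex.ofReal_sin,
    Complex.ofReal_sin, ← h, fejerKernel, mul_div_right_comm, Finset.sum_div]
  push_cast
  congr 1
  refine Finset.sum_congr rfl fun k _ => ?_
  have hexponent : 2 * Complex.I * k / (N + 1) * u = 2 * k * (u / (N + 1)) * Complex.I := by ring
  simp only [fourier_dilate, fejerCoeff, pow_zero, mul_one, Complex.ofReal_div, Complex.ofReal_sub,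
    Complex.ofReal_add, Complex.ofReal_natCast, Complex.ofReal_one, Complex.ofReal_intCast,
    Complex.ofReal_pow, hexponent]
  rw [div_mul_eq_mul_div]

end Kernel

/-! ### Decay of the derivatives of the Fejér kernel -/

section Leibniz

variable {𝕜 A : Type*} [NontriviallyNormedField 𝕜]

lemma iteratedDeriv_eq_of_hasDerivAt_succ [NormedAddCommGroup A] [NormedSpace 𝕜 A]
    {f : ℕ → 𝕜 → A} (hf : ∀ n x, HasDerivAt (f n) (f (n + 1) x) x) (n : ℕ) :
    iteratedDeriv n (f 0) = f n := by
  induction n with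
  | zero => rw [iteratedDeriv_zero]
  | succ n ih => rw [iteratedDeriv_succ, ih, funext fun x => (hf n x).deriv]

lemma contDiff_of_hasDerivAt_succ [NormedAddCommGroup A] [NormedSpace 𝕜 A]
    {f : ℕ → 𝕜 → A} (hf : ∀ n x, HasDerivAt (f n) (f (n + 1) x) x) {n : ℕ} :
    ContDiff 𝕜 n (f 0) := by
  refine contDiff_of_differentiable_iteratedDeriv (n := (n : ℕ∞)) fun m _ => ?_
  rw [iteratedDeriv_eq_of_hasDerivAt_succ hf]
  exact fun x => (hf m x).differentiableAt

lemma eq_sum_choose_mul_of_hasDerivAt_succ [NormedRing A] [NormedAlgebra 𝕜 A]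
    {f g h : ℕ → 𝕜 → A} (hf : ∀ n x, HasDerivAt (f n) (f (n + 1) x) x)
    (hg : ∀ n x, HasDerivAt (g n) (g (n + 1) x) x) (hh : ∀ n x, HasDerivAt (h n) (h (n + 1) x) x)
    (hfg : ∀ x, f 0 x * g 0 x = h 0 x) (n : ℕ) (x : 𝕜) :
    h n x = ∑ m ∈ Finset.range (n + 1), n.choose m * f m x * g (n - m) x := by
  have hmul := iteratedDeriv_mul (n := n) (contDiff_of_hasDerivAt_succ hf).contDiffAt
    (contDiff_of_hasDerivAt_succ hg).contDiffAt (x := x)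
  rw [show f 0 * g 0 = h 0 from funext hfg] at hmul
  simpa only [iteratedDeriv_eq_of_hasDerivAt_succ hf, iteratedDeriv_eq_of_hasDerivAt_succ hg,
    iteratedDeriv_eq_of_hasDerivAt_succ hh] using hmul

end Leibniz

/-- The `n`-th derivative of `sin (ω u) ^ 2 = (1 - cos (2 ω u)) / 2` with respect to `u`. -/
noncomputable def sinSqDeriv (ω : ℝ) (n : ℕ) (u : ℝ) : ℝ :=
  (0 ^ n - (2 * ω) ^ n * Real.cos (2 * ω * u + n * (π / 2))) / 2

section SinSqDeriv

variable (ω : ℝ) (n : ℕ) (u : ℝ)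

lemma sinSqDeriv_zero : sinSqDeriv ω 0 u = Real.sin (ω * u) ^ 2 := by
  rw [sinSqDeriv, Real.sin_sq_eq_half_sub]
  push_cast
  ring_nf

lemma hasDerivAt_sinSqDeriv : HasDerivAt (sinSqDeriv ω n) (sinSqDeriv ω (n + 1) u) u := by
  have hphase : HasDerivAt (fun u => 2 * ω * u + n * (π / 2)) (2 * ω) u := by
    simpa only [mul_one] using ((hasDerivAt_id' u).const_mul (2 * ω)).add_const (n * (π / 2))
  convert! ((hphase.cos.const_mul ((2 * ω) ^ n)).const_sub (0 ^ n)).div_const 2 using 1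
  have hcos : Real.cos (2 * ω * u + (n + 1 : ℕ) * (π / 2))
      = -Real.sin (2 * ω * u + n * (π / 2)) := by
    rw [← Real.cos_add_pi_div_two]
    push_cast
    ring_nf
  rw [sinSqDeriv, hcos]
  ring

lemma abs_sinSqDeriv_one_le : |sinSqDeriv 1 n u| ≤ 2 ^ (n - 1) := by
  rcases n with _ | n
  · rw [sinSqDeriv_zero, abs_of_nonneg (sq_nonneg _), zero_tsub, pow_zero]
    exact Real.sin_sq_le_one _
  · have hcos := Real.abs_cos_le_one (2 * 1 * u + (n + 1 : ℕ) * (π / 2))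
    rw [sinSqDeriv, zero_pow n.succ_ne_zero, zero_sub, abs_div, abs_neg, abs_mul, abs_two,
      div_le_iff₀ two_pos, mul_one, abs_of_pos (by positivity), Nat.add_sub_cancel, ← pow_succ]
    exact mul_le_of_le_one_right (by positivity) (by simpa only [mul_one] using hcos)

variable {ω n u}

lemma abs_sinSqDeriv_le (hω : 0 ≤ ω) (hn : n ≠ 0) (hu : Real.sin (ω * u) ≠ 0) :
    |sinSqDeriv ω n u| ≤ Real.sin (ω * u) ^ 2 * (2 * (ω / |Real.sin (ω * u)|)) ^ n := by
  have hs : 0 < |Real.sin (ω * u)| := abs_pos.mpr hu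
  have hs1 : |Real.sin (ω * u)| ≤ 1 := Real.abs_sin_le_one _
  have habs : |sinSqDeriv ω n u| = (2 * ω) ^ n * (|Real.cos (2 * ω * u + n * (π / 2))| / 2) := by
    rw [sinSqDeriv, zero_pow hn, zero_sub, abs_div, abs_neg, abs_mul, abs_two,
      abs_of_nonneg (by positivity), mul_div_assoc]
  have hcos : |Real.cos (2 * ω * u + n * (π / 2))| / 2 * |Real.sin (ω * u)| ^ n
      ≤ |Real.sin (ω * u)| ^ 2 := by
    obtain rfl | hn2 : n = 1 ∨ 2 ≤ n := by omega
    · rw [Nat.cast_one, one_mul, Real.cos_add_pi_div_two, abs_neg, mul_assoc 2, Real.sin_two_mul,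
        abs_mul, abs_mul, abs_two]
      have := mul_le_of_le_one_right (sq_nonneg |Real.sin (ω * u)|) (Real.abs_cos_le_one (ω * u))
      linarith
    · calc _ ≤ 1 * |Real.sin (ω * u)| ^ n := by
            gcongr
            linarith [Real.abs_cos_le_one (2 * ω * u + n * (π / 2))]
        _ ≤ |Real.sin (ω * u)| ^ 2 := by
            rw [one_mul]
            exact pow_le_pow_of_le_one hs.le hs1 hn2
  have hpow : (2 * (ω / |Real.sin (ω * u)|)) ^ n = (2 * ω) ^ n / |Real.sin (ω * u)| ^ n := by
    rw [← mul_div_assoc, div_pow]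
  rw [habs, hpow, mul_div_left_comm (Real.sin _ ^ 2), ← sq_abs (Real.sin _)]
  exact mul_le_mul_of_nonneg_left ((le_div_iff₀ (by positivity)).mpr hcos) (by positivity)

end SinSqDeriv

/-- The polynomials `P n` in the bound `‖K⁽ⁿ⁾‖ ≤ z ^ 2 * P n z` for the derivatives of the Fejér
kernel, where `z = 1 / ((N + 1) |sin (u / (N + 1))|)`. The recursion is Leibniz' rule applied to
`K(u) sin(u / (N + 1)) ^ 2 = (sin u / (N + 1)) ^ 2` and solved for the highest derivative of `K`;
for `n = 0` the truncated exponent `n - 1` makes the first term `1`. -/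
noncomputable def fejerDecayPoly (z : ℝ) (n : ℕ) : ℝ :=
  2 ^ (n - 1) + ∑ m : Fin n, n.choose m * fejerDecayPoly z m * (2 * z) ^ (n - m)

section FejerDecayPoly

variable (z : ℝ)

lemma fejerDecayPoly_zero : fejerDecayPoly z 0 = 1 := by
  rw [fejerDecayPoly, Fin.sum_univ_zero, zero_tsub, pow_zero, add_zero]

lemma fejerDecayPoly_one : fejerDecayPoly z 1 = 1 + 2 * z := by
  rw [fejerDecayPoly, Fin.sum_univ_one, Fin.val_zero, fejerDecayPoly_zero]
  norm_num

lemma fejerDecayPoly_two : fejerDecayPoly z 2 = 2 + 4 * z + 12 * z ^ 2 := by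
  rw [fejerDecayPoly, Fin.sum_univ_two, Fin.val_zero, Fin.val_one, fejerDecayPoly_zero,
    fejerDecayPoly_one]
  norm_num
  ring

lemma fejerDecayPoly_three : fejerDecayPoly z 3 = 4 + 12 * z + 36 * z ^ 2 + 104 * z ^ 3 := by
  rw [fejerDecayPoly, Fin.sum_univ_three, Fin.val_zero, Fin.val_one, Fin.val_two,
    fejerDecayPoly_zero, fejerDecayPoly_one, fejerDecayPoly_two]
  norm_num [Nat.choose]
  ring

variable {z}

lemma fejerDecayPoly_nonneg (hz : 0 ≤ z) (n : ℕ) : 0 ≤ fejerDecayPoly z n := by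
  induction n using Nat.strong_induction_on with | _ n ih
  rw [fejerDecayPoly]
  exact add_nonneg (by positivity) (Finset.sum_nonneg fun m _ =>
    mul_nonneg (mul_nonneg (Nat.cast_nonneg _) (ih m m.2)) (by positivity))

lemma fejerDecayPoly_le_fejerDecayPoly {Z : ℝ} (hz : 0 ≤ z) (hzZ : z ≤ Z) (n : ℕ) :
    fejerDecayPoly z n ≤ fejerDecayPoly Z n := by
  induction n using Nat.strong_induction_on with | _ n ih
  rw [fejerDecayPoly, fejerDecayPoly]
  gcongr with m
  · exact mul_nonneg (Nat.cast_nonneg _) (fejerDecayPoly_nonneg (hz.trans hzZ) m)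
  · exact ih m m.2

end FejerDecayPoly

lemma fejerKernel_dilate_leibniz (N n : ℕ) (u : ℝ) :
    ((sinSqDeriv 1 n u / (N + 1) ^ 2 : ℝ) : ℂ)
      = ∑ m ∈ Finset.range n, (n.choose m : ℂ) * fejerKernel N m (dilate N u)
          * sinSqDeriv (1 / (N + 1)) (n - m) u
        + fejerKernel N n (dilate N u) * (Real.sin (u / (N + 1)) ^ 2 : ℝ) := by
  have hleibniz := eq_sum_choose_mul_of_hasDerivAt_succ
    (f := fun n u => fejerKernel N n (dilate N u))
    (g := fun n u => (sinSqDeriv (1 / (N + 1)) n u : ℂ))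
    (h := fun n u => ((sinSqDeriv 1 n u / (N + 1) ^ 2 : ℝ) : ℂ)) (hasDerivAt_fejerKernel_dilate N)
    (fun n u => (hasDerivAt_sinSqDeriv _ n u).ofReal_comp)
    (fun n u => ((hasDerivAt_sinSqDeriv 1 n u).div_const _).ofReal_comp)
    (fun u => by
      simpa only [sinSqDeriv_zero, one_mul, one_div_mul_eq_div]
        using fejerKernel_zero_dilate_mul_sin_sq N u) n u
  simpa only [Finset.sum_range_succ, Nat.choose_self, Nat.cast_one, one_mul, Nat.sub_self,
    sinSqDeriv_zero, one_div_mul_eq_div] using hleibniz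

lemma norm_fejerKernel_dilate_le (N n : ℕ) {u : ℝ} (hu : Real.sin (u / (N + 1)) ≠ 0) :
    ‖fejerKernel N n (dilate N u)‖ ≤ (1 / ((N + 1) * |Real.sin (u / (N + 1))|)) ^ 2 *
      fejerDecayPoly (1 / ((N + 1) * |Real.sin (u / (N + 1))|)) n := by
  induction n using Nat.strong_induction_on with | _ n ih
  have hleibniz := fejerKernel_dilate_leibniz N n u
  set M : ℝ := N + 1
  set z : ℝ := 1 / (M * |Real.sin (u / M)|)
  have hM : 0 < M := by positivity
  have hs : 0 < Real.sin (u / M) ^ 2 := by positivity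
  have hz : 0 ≤ z := by positivity
  have hsz : Real.sin (u / M) ^ 2 * z ^ 2 = 1 / M ^ 2 := by
    rw [div_pow, mul_pow, sq_abs]
    field_simp
  have hsinSq (m : ℕ) (hm : m < n) :
      |sinSqDeriv (1 / M) (n - m) u| ≤ Real.sin (u / M) ^ 2 * (2 * z) ^ (n - m) := by
    have := abs_sinSqDeriv_le (ω := 1 / M) (n := n - m) (u := u) (by positivity) (by omega)
      (by rwa [one_div_mul_eq_div])
    rwa [one_div_mul_eq_div, div_div] at this
  have hnorm : ‖fejerKernel N n (dilate N u)‖ * Real.sin (u / M) ^ 2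
      = ‖((sinSqDeriv 1 n u / M ^ 2 : ℝ) : ℂ) - ∑ m ∈ Finset.range n,
          (n.choose m : ℂ) * fejerKernel N m (dilate N u) * sinSqDeriv (1 / M) (n - m) u‖ := by
    rw [hleibniz, add_sub_cancel_left, norm_mul, Complex.norm_real,
      Real.norm_of_nonneg (sq_nonneg _)]
  rw [← mul_le_mul_iff_left₀ hs, hnorm]
  calc _ ≤ 2 ^ (n - 1) / M ^ 2 + ∑ m ∈ Finset.range n, n.choose m * (z ^ 2 * fejerDecayPoly z m)
          * (Real.sin (u / M) ^ 2 * (2 * z) ^ (n - m)) := by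
        refine (norm_sub_le _ _).trans (add_le_add ?_ (norm_sum_le_of_le _ fun m hm => ?_))
        · rw [Complex.norm_real, norm_div, Real.norm_eq_abs, Real.norm_of_nonneg (by positivity)]
          gcongr
          exact abs_sinSqDeriv_one_le n u
        · rw [norm_mul, norm_mul, Complex.norm_natCast, Complex.norm_real, Real.norm_eq_abs]
          have hm := Finset.mem_range.mp hm
          have hP := fejerDecayPoly_nonneg hz m
          exact mul_le_mul (mul_le_mul_of_nonneg_left (ih m hm) (Nat.cast_nonneg _)) (hsinSq m hm)
            (abs_nonneg _) (by positivity)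
    _ = z ^ 2 * fejerDecayPoly z n * Real.sin (u / M) ^ 2 := by
        rw [fejerDecayPoly, div_eq_mul_one_div, ← hsz, Finset.sum_range, mul_add, add_mul,
          Finset.mul_sum, Finset.sum_mul]
        congr 1
        · ring
        · exact Finset.sum_congr rfl fun m _ => by ring

lemma abs_mul_cos_le_abs_sin {y : ℝ} (hy : |y| ≤ π / 2) : |y| * Real.cos y ≤ |Real.sin y| := by
  have hπ := Real.pi_pos
  rw [← Real.cos_abs y, Real.abs_sin_eq_sin_abs_of_abs_le_pi (by linarith)]
  rcases hy.lt_or_eq with hlt | heq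
  · have hcos : 0 < Real.cos |y| :=
      Real.cos_pos_of_mem_Ioo ⟨by linarith [abs_nonneg y], hlt⟩
    rw [← le_div_iff₀ hcos, ← Real.tan_eq_sin_div_cos]
    exact Real.le_tan (abs_nonneg y) hlt
  · rw [heq, Real.cos_pi_div_two, mul_zero]
    exact Real.sin_nonneg_of_nonneg_of_le_pi (by linarith) (by linarith)

lemma sq_le_sin_sq_mul {y : ℝ} (hy : |y| ≤ π / 2) : y ^ 2 ≤ Real.sin y ^ 2 * (1 + y ^ 2) := by
  have hcos : 0 ≤ Real.cos y :=
    Real.cos_nonneg_of_neg_pi_div_two_le_of_le (neg_le_of_abs_le hy) (le_of_abs_le hy)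
  have h := pow_le_pow_left₀ (mul_nonneg (abs_nonneg y) hcos) (abs_mul_cos_le_abs_sin hy) 2
  rw [mul_pow, sq_abs, sq_abs, Real.cos_sq'] at h
  linarith

/-- The quadratic decay profile of the Fejér kernel: `1 / (π (N + 1) ‖x‖) ^ 2`, up to a correction
which makes up for replacing a sine by its argument. -/
noncomputable def decay (N : ℕ) (x : UnitAddCircle) : ℝ :=
  1 / (π * (N + 1) * ‖x‖) ^ 2 + 1 / ((N : ℝ) + 1) ^ 2

lemma decay_nonneg (N : ℕ) (x : UnitAddCircle) : 0 ≤ decay N x := by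
  rw [decay]; positivity

lemma norm_fejerKernel_le_decay (N n : ℕ) {x : UnitAddCircle} (hx : x ≠ 0) {Z : ℝ} (hZ : 0 ≤ Z)
    (hdecay : decay N x ≤ Z ^ 2) : ‖fejerKernel N n x‖ ≤ decay N x * fejerDecayPoly Z n := by
  obtain ⟨u, rfl, hu⟩ := exists_dilate_eq N x
  have : 0 < ‖dilate N u‖ := norm_pos_iff.mpr hx
  have hhalf : ‖dilate N u‖ ≤ 1 / 2 := by
    simpa using AddCircle.norm_le_half_period 1 one_ne_zero (x := dilate N u)
  have hu0 : u ≠ 0 := abs_pos.mp (by rw [hu]; positivity)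
  have hsq := sq_le_sin_sq_mul (y := u / (N + 1)) (by
    rw [abs_div, hu, abs_of_pos (by positivity : (0 : ℝ) < N + 1)]
    field_simp
    linarith)
  have hsin : Real.sin (u / (N + 1)) ≠ 0 := fun h => hx (dilate_eq_zero_of_sin_eq_zero h)
  have hz : (1 / ((N + 1) * |Real.sin (u / (N + 1))|)) ^ 2 ≤ decay N (dilate N u) := by
    have : 0 < Real.sin (u / (N + 1)) ^ 2 := by positivity
    rw [decay, ← hu, sq_abs, div_pow, mul_pow, sq_abs, one_pow, div_le_iff₀ (by positivity)]
    calc (1 : ℝ) = (u / (N + 1)) ^ 2 * ((N + 1) ^ 2 / u ^ 2) := by field_simp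
      _ ≤ Real.sin (u / (N + 1)) ^ 2 * (1 + (u / (N + 1)) ^ 2) * ((N + 1) ^ 2 / u ^ 2) := by gcongr
      _ = _ := by field_simp
  have hzZ := le_of_sq_le_sq (hz.trans hdecay) hZ
  refine (norm_fejerKernel_dilate_le N n hsin).trans (mul_le_mul hz
    (fejerDecayPoly_le_fejerDecayPoly (by positivity) hzZ n)
    (fejerDecayPoly_nonneg (by positivity) n) (decay_nonneg _ _))

/-! ### The Fejér kernel near the origin -/

section KernelAtZero

variable (N : ℕ)

lemma fejerKernel_zero_apply_zero : fejerKernel N 0 0 = 1 := by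
  have h := fejerMoment_zero N
  simp only [fejerMoment, pow_zero, mul_one] at h
  simp only [fejerKernel, pow_zero, mul_one, fourier_eval_zero]
  exact_mod_cast h

lemma fejerKernel_one_apply_zero : fejerKernel N 1 0 = 0 := by
  refine self_eq_neg.mp ?_
  rw [fejerKernel, ← Finset.sum_neg_distrib]
  refine Finset.sum_equiv (Equiv.neg ℤ) (fun k => ?_) fun k _ => ?_
  · rw [Equiv.neg_apply, Finset.mem_Icc, Finset.mem_Icc]
    omega
  · simp only [Equiv.neg_apply, fejerCoeff, abs_neg, fourier_eval_zero, pow_one, Int.cast_neg]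
    ring

lemma fejerKernel_two_apply_zero : fejerKernel N 2 0 = -(fejerMoment N 2 : ℂ) := by
  rw [fejerKernel, fejerMoment, Complex.ofReal_sum, ← Finset.sum_neg_distrib]
  refine Finset.sum_congr rfl fun k _ => ?_
  have habs : (2 * (|k| : ℤ) / (N + 1) : ℝ) ^ 2 = (2 * k / (N + 1)) ^ 2 := by
    rw [Int.cast_abs, div_pow, mul_pow, sq_abs, ← mul_pow, ← div_pow]
  have hI : 2 * Complex.I * k / (N + 1) = Complex.I * (2 * k / (N + 1)) := by ring
  rw [habs, fourier_eval_zero, hI, mul_pow, Complex.I_sq]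
  push_cast
  ring

end KernelAtZero

lemma cos_le_one_sub_sq_div_add_pow_four_div (x : ℝ) :
    Real.cos x ≤ 1 - x ^ 2 / 2 + x ^ 4 / 24 := by
  wlog hx : 0 ≤ x generalizing x
  · simpa only [Real.cos_neg, even_two.neg_pow, (by decide : Even 4).neg_pow]
      using this (-x) (by linarith)
  have hderiv (y : ℝ) : HasDerivAt (fun y => 1 - y ^ 2 / 2 + y ^ 4 / 24 - Real.cos y)
      (Real.sin y - (y - y ^ 3 / 6)) y := by
    convert! ((((hasDerivAt_pow 2 y).div_const 2).const_sub 1).add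
      ((hasDerivAt_pow 4 y).div_const 24)).sub (Real.hasDerivAt_cos y) using 1
    ring
  have hmono : MonotoneOn (fun y => 1 - y ^ 2 / 2 + y ^ 4 / 24 - Real.cos y) (Set.Ici 0) := by
    refine monotoneOn_of_hasDerivWithinAt_nonneg (convex_Ici 0)
      (fun y _ => (hderiv y).continuousAt.continuousWithinAt)
      (fun y _ => (hderiv y).hasDerivWithinAt) fun y hy => ?_
    rw [interior_Ici] at hy
    exact sub_nonneg.mpr (Real.sin_ge_sub_cube (Set.mem_Ioi.mp hy).le)
  have h := hmono Set.self_mem_Ici hx hx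
  norm_num at h
  linarith

lemma fejerKernel_zero_dilate_re (N : ℕ) (u : ℝ) : (fejerKernel N 0 (dilate N u)).re
    = ∑ k ∈ Finset.Icc (-(N : ℤ)) N, fejerCoeff N k * Real.cos (2 * k / (N + 1) * u) := by
  rw [fejerKernel, Complex.re_sum]
  refine Finset.sum_congr rfl fun k _ => ?_
  have hexponent : 2 * Complex.I * k / (N + 1) * u = (2 * k / (N + 1) * u : ℝ) * Complex.I := by
    push_cast
    ring
  rw [pow_zero, mul_one, fourier_dilate, hexponent, Complex.re_ofReal_mul,
    Complex.exp_ofReal_mul_I_re]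

lemma fejerKernel_zero_dilate_re_le (N : ℕ) (u : ℝ) : (fejerKernel N 0 (dilate N u)).re
    ≤ 1 - fejerMoment N 2 / 2 * u ^ 2 + fejerMoment N 4 / 24 * u ^ 4 := by
  refine le_of_le_of_eq (b := fejerMoment N 0 - fejerMoment N 2 / 2 * u ^ 2
    + fejerMoment N 4 / 24 * u ^ 4) ?_ (by rw [fejerMoment_zero])
  rw [fejerKernel_zero_dilate_re]
  simp only [fejerMoment, Finset.sum_div, Finset.sum_mul]
  rw [← Finset.sum_sub_distrib, ← Finset.sum_add_distrib]
  refine Finset.sum_le_sum fun k hk => ?_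
  have habs : |(2 * k / (N + 1) : ℝ)| = 2 * (|k| : ℤ) / (N + 1) := by
    rw [abs_div, abs_mul, abs_two, Int.cast_abs, abs_of_pos (by positivity : (0 : ℝ) < N + 1)]
  have hcos := mul_le_mul_of_nonneg_left
    (cos_le_one_sub_sq_div_add_pow_four_div (2 * k / (N + 1) * u)) (fejerCoeff_nonneg hk)
  rw [mul_pow, mul_pow, ← even_two.pow_abs, ← (by decide : Even 4).pow_abs, habs] at hcos
  linarith

lemma norm_fejerKernel_zero_eq_re (N : ℕ) (x : UnitAddCircle) :
    ‖fejerKernel N 0 x‖ = (fejerKernel N 0 x).re := by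
  obtain ⟨u, rfl, -⟩ := exists_dilate_eq N x
  by_cases hu : Real.sin (u / (N + 1)) = 0
  · rw [dilate_eq_zero_of_sin_eq_zero hu, fejerKernel_zero_apply_zero, norm_one, Complex.one_re]
  · have hsin : (0 : ℝ) < Real.sin (u / (N + 1)) ^ 2 := by positivity
    have hkernel : fejerKernel N 0 (dilate N u)
        = (Real.sin u ^ 2 / (N + 1) ^ 2 / Real.sin (u / (N + 1)) ^ 2 : ℝ) := by
      rw [Complex.ofReal_div, eq_div_iff (by exact_mod_cast hsin.ne')]
      exact fejerKernel_zero_dilate_mul_sin_sq N u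
    rw [hkernel, Complex.norm_real, Complex.ofReal_re, Real.norm_of_nonneg (by positivity)]

lemma norm_fejerKernel_zero_le {N : ℕ} (hN : 128 ≤ N) {x : UnitAddCircle}
    (hx : (π * (N + 1) * ‖x‖) ^ 2 ≤ 1.58) :
    ‖fejerKernel N 0 x‖ ≤ 1 - 0.263 * (π * (N + 1) * ‖x‖) ^ 2 := by
  rw [norm_fejerKernel_zero_eq_re]
  obtain ⟨u, rfl, hu⟩ := exists_dilate_eq N x
  rw [← hu, sq_abs] at hx ⊢
  have hre := fejerKernel_zero_dilate_re_le N u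
  have h2 := mul_le_mul_of_nonneg_right (le_fejerMoment_two hN) (sq_nonneg u)
  have h4 := mul_le_mul_of_nonneg_right (fejerMoment_four_le N) (by positivity : 0 ≤ u ^ 4)
  have hu4 := mul_le_mul_of_nonneg_right hx (sq_nonneg u)
  norm_num at h2 hu4 ⊢
  linarith [sq_nonneg u]

lemma decay_le {N : ℕ} (hN : 128 ≤ N) {x : UnitAddCircle} {c : ℝ} (hc : 0 < c)
    (hx : c ≤ (N + 1) * ‖x‖) : decay N x ≤ 1 / (9.869 * c ^ 2) + 0.0001 := by
  have hN' : (129 : ℝ) ≤ N + 1 := by exact_mod_cast Nat.succ_le_succ hN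
  have hπ := Real.pi_gt_d6
  rw [decay, mul_assoc]
  gcongr
  · calc 9.869 * c ^ 2 ≤ (π * c) ^ 2 := by
          rw [mul_pow]
          gcongr
          nlinarith
      _ ≤ (π * ((N + 1) * ‖x‖)) ^ 2 := by gcongr
  · calc 1 / ((N : ℝ) + 1) ^ 2 ≤ 1 / 129 ^ 2 := by gcongr
      _ ≤ 0.0001 := by norm_num

lemma norm_fejerKernel_zero_le_of_le {N : ℕ} (hN : 128 ≤ N) {x : UnitAddCircle} {c : ℝ}
    (hc : 0 < c) (hx : c ≤ (N + 1) * ‖x‖) :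
    ‖fejerKernel N 0 x‖ ≤ 1 / (9.869 * c ^ 2) + 0.0001 := by
  have hx0 : x ≠ 0 := norm_pos_iff.mp (by nlinarith [N.cast_nonneg (α := ℝ), norm_nonneg x])
  refine le_trans ?_ (decay_le hN hc hx)
  simpa only [fejerDecayPoly_zero, mul_one] using norm_fejerKernel_le_decay N 0 hx0
    (Real.sqrt_nonneg _) (Real.sq_sqrt (decay_nonneg N x)).ge

/-! ### Sums over separated points -/

section Truncate

variable {y z : ℝ}

/-- The integer part of `y`, rounded towards zero. -/
noncomputable def truncate (y : ℝ) : ℤ := if 0 ≤ y then ⌊y⌋ else ⌈y⌉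

lemma truncate_of_nonneg (hy : 0 ≤ y) : truncate y = ⌊y⌋ := if_pos hy

lemma truncate_of_neg (hy : y < 0) : truncate y = ⌈y⌉ := if_neg hy.not_ge

lemma truncate_nonneg (hy : 0 ≤ y) : 0 ≤ truncate y := by
  rw [truncate_of_nonneg hy]
  exact Int.floor_nonneg.mpr hy

lemma truncate_nonpos (hy : y < 0) : truncate y ≤ 0 := by
  rw [truncate_of_neg hy]
  exact Int.ceil_nonpos.mpr hy.le

lemma abs_truncate_le : |(truncate y : ℝ)| ≤ |y| := by
  rcases le_or_gt 0 y with hy | hy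
  · rw [abs_of_nonneg (by exact_mod_cast truncate_nonneg hy), abs_of_nonneg hy,
      truncate_of_nonneg hy]
    exact Int.floor_le y
  · rw [abs_of_nonpos (by exact_mod_cast truncate_nonpos hy), abs_of_neg hy, truncate_of_neg hy]
    exact neg_le_neg (Int.le_ceil y)

lemma truncate_ne_zero (hy : 1 ≤ |y|) : truncate y ≠ 0 := by
  rcases le_abs'.mp hy with hy | hy
  · rw [truncate_of_neg (by linarith)]
    exact ((Int.ceil_le (z := -1)).mpr (by push_cast; linarith)).trans_lt neg_one_lt_zero |>.ne
  · rw [truncate_of_nonneg (by linarith)]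
    exact (Int.floor_pos.mpr hy).ne'

lemma abs_sub_lt_one_of_truncate_eq (hyz : truncate y = truncate z) (hy : truncate y ≠ 0) :
    |y - z| < 1 := by
  wlog h : z ≤ y generalizing y z
  · rw [abs_sub_comm]
    exact this hyz.symm (hyz ▸ hy) (le_of_not_ge h)
  rcases le_or_gt 0 z with hz | hz
  · rw [truncate_of_nonneg (hz.trans h), truncate_of_nonneg hz] at hyz
    exact Int.abs_sub_lt_one_of_floor_eq_floor hyz
  rcases lt_or_ge y 0 with hy0 | hy0
  · rw [truncate_of_neg hy0, truncate_of_neg hz, ← neg_inj, ← Int.floor_neg, ← Int.floor_neg] at hyz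
    rw [abs_sub_comm, ← neg_sub_neg]
    exact Int.abs_sub_lt_one_of_floor_eq_floor hyz
  · have := truncate_nonneg hy0
    have := truncate_nonpos hz
    omega

end Truncate

/-- The numbering `n` ranks the points of the family `T` other than `T j` by their signed position
relative to `T j`, in such a way that the rank times `D` is at most the distance to `T j`. -/
structure IsRanking {ι : Type*} (T : ι → UnitAddCircle) (D : ℝ) (j : ι) (n : ι → ℤ) : Prop where
  injOn : Set.InjOn n {j}ᶜ
  ne_zero : ∀ i ≠ j, n i ≠ 0
  abs_mul_le : ∀ i, |(n i : ℝ)| * D ≤ ‖T i - T j‖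

lemma norm_coe_le_abs (u : ℝ) : ‖(u : UnitAddCircle)‖ ≤ |u| :=
  QuotientAddGroup.norm_mk_le_norm

section Separation

variable {ι : Type*} {T : ι → UnitAddCircle} {D : ℝ}

lemma exists_isRanking (hD : 0 < D) (hT : ∀ i j, i ≠ j → D ≤ ‖T i - T j‖) (j : ι) :
    ∃ n, IsRanking T D j n := by
  have hlift (i : ι) : ∃ u : ℝ, (u : UnitAddCircle) = T i - T j ∧ |u| = ‖T i - T j‖ := by
    obtain ⟨u, hu, hu'⟩ := exists_dilate_eq 0 (T i - T j)
    refine ⟨_, hu, ?_⟩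
    rw [abs_div, hu', abs_of_pos (by positivity), mul_div_cancel_left₀ _ (by positivity)]
  choose u hu habs using hlift
  have hsep (i : ι) (hi : i ≠ j) : truncate (u i / D) ≠ 0 := by
    refine truncate_ne_zero ?_
    rw [abs_div, abs_of_pos hD, habs, one_le_div hD]
    exact hT i j hi
  refine ⟨fun i => truncate (u i / D), fun i hi k _ hik => ?_, hsep, fun i => ?_⟩
  · by_contra hne
    have hlt := abs_sub_lt_one_of_truncate_eq hik (hsep i hi)
    rw [← sub_div, abs_div, abs_of_pos hD, div_lt_one hD] at hlt
    refine hlt.not_ge ((hT i k hne).trans ?_)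
    rw [← sub_sub_sub_cancel_right _ _ (T j), ← hu, ← hu, ← AddCircle.coe_sub]
    exact norm_coe_le_abs _
  · rw [← habs, ← le_div_iff₀ hD, ← abs_of_pos hD, ← abs_div, abs_of_pos hD]
    exact abs_truncate_le

end Separation

lemma hasSum_int_one_div_sq : HasSum (fun n : ℤ => 1 / (n : ℝ) ^ 2) (π ^ 2 / 3) := by
  have hpos : HasSum (fun n : ℕ => 1 / ((n : ℤ) : ℝ) ^ 2) (π ^ 2 / 6) := by
    simpa only [Int.cast_natCast] using hasSum_zeta_two
  have hneg : HasSum (fun n : ℕ => 1 / ((-((n : ℤ) + 1) : ℤ) : ℝ) ^ 2) (π ^ 2 / 6) := by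
    have h := (hasSum_nat_add_iff' (f := fun n : ℕ => 1 / (n : ℝ) ^ 2) 1).mpr hasSum_zeta_two
    simp only [Finset.sum_range_one, Nat.cast_zero, sq, zero_mul, div_zero, sub_zero] at h
    push_cast
    simpa only [sq, neg_mul_neg, Nat.cast_add, Nat.cast_one] using h
  rw [show π ^ 2 / 3 = π ^ 2 / 6 + π ^ 2 / 6 by ring]
  exact HasSum.of_nat_of_neg_add_one (f := fun n : ℤ => 1 / (n : ℝ) ^ 2) hpos hneg

lemma sum_one_div_sq_le {ι : Type*} {S : Finset ι} {n : ι → ℤ} (hn : Set.InjOn n S) :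
    ∑ i ∈ S, 1 / (n i : ℝ) ^ 2 ≤ π ^ 2 / 3 := by
  classical
  rw [← Finset.sum_image (f := fun m : ℤ => 1 / (m : ℝ) ^ 2) hn]
  exact sum_le_hasSum _ (fun m _ => by positivity) hasSum_int_one_div_sq

lemma card_le_of_injOn_of_abs_le {ι : Type*} {S : Finset ι} {n : ι → ℤ} (hn : Set.InjOn n S)
    {L : ℝ} (hL : 0 ≤ L) (h0 : ∀ i ∈ S, n i ≠ 0) (h : ∀ i ∈ S, |(n i : ℝ)| ≤ L) :
    (S.card : ℝ) ≤ 2 * L := by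
  classical
  have hsub : S.image n ⊆ (Finset.Icc (-⌊L⌋) ⌊L⌋).erase 0 := by
    intro m hm
    obtain ⟨i, hi, rfl⟩ := Finset.mem_image.mp hm
    rw [Finset.mem_erase, Finset.mem_Icc, ← abs_le, Int.le_floor, Int.cast_abs]
    exact ⟨h0 i hi, h i hi⟩
  have hcard := Finset.card_le_card hsub
  have hfloor : 0 ≤ ⌊L⌋ := Int.floor_nonneg.mpr hL
  have hzero : (0 : ℤ) ∈ Finset.Icc (-⌊L⌋) ⌊L⌋ := Finset.mem_Icc.mpr ⟨by omega, hfloor⟩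
  rw [Finset.card_image_of_injOn hn, Finset.card_erase_of_mem hzero, Int.card_Icc] at hcard
  have hcard' : (S.card : ℝ) ≤ 2 * ⌊L⌋ := by exact_mod_cast (by omega : (S.card : ℤ) ≤ 2 * ⌊L⌋)
  linarith [Int.floor_le L]

section RowSums

variable {ι : Type*} {T : ι → UnitAddCircle} {n : ι → ℤ} {j : ι} {N : ℕ} {δ c : ℝ}
  {x : UnitAddCircle}

lemma IsRanking.mul_abs_le (hn : IsRanking T (δ / N) j n) (hN : 0 < N) (i : ι) :
    δ * |(n i : ℝ)| ≤ (N + 1) * ‖x - T i‖ + (N + 1) * ‖x - T j‖ := by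
  have hN' : (0 : ℝ) < N := by exact_mod_cast hN
  have hrank := hn.abs_mul_le i
  rw [mul_div_assoc', div_le_iff₀ hN'] at hrank
  have htri : ‖T i - T j‖ ≤ ‖x - T i‖ + ‖x - T j‖ := by
    rw [← norm_neg (x - T i), ← sub_add_sub_cancel _ x, neg_sub]
    exact norm_add_le _ _
  nlinarith [norm_nonneg (T i - T j)]

variable [Fintype ι] [DecidableEq ι]

lemma IsRanking.card_erase_le (hn : IsRanking T (δ / N) j n) (hN : 0 < N) (hδ : 0 < δ) :
    ((Finset.univ.erase j).card : ℝ) ≤ N / δ := by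
  have : (0 : ℝ) < N := by exact_mod_cast hN
  rw [← mul_div_cancel₀ (N / δ : ℝ) two_ne_zero]
  refine card_le_of_injOn_of_abs_le (n := n) (hn.injOn.mono fun i hi => ?_) (by positivity)
    (fun i hi => hn.ne_zero i (Finset.ne_of_mem_erase hi)) fun i _ => ?_
  · exact Finset.ne_of_mem_erase (Finset.mem_coe.mp hi)
  · have hhalf : ‖T i - T j‖ ≤ 1 / 2 := by
      simpa only [abs_one] using AddCircle.norm_le_half_period 1 one_ne_zero (x := T i - T j)
    have h := (hn.abs_mul_le i).trans hhalf
    rw [← le_div_iff₀ (by positivity), div_div_eq_mul_div] at h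
    rwa [div_div, mul_comm δ, ← div_div, ← one_div_mul_eq_div _ (N : ℝ)]

lemma IsRanking.sum_decay_le (hn : IsRanking T (δ / N) j n) (hN : 0 < N) (hδ : 0 < δ) (hc : 0 < c)
    (hx : ∀ i ≠ j, c * |(n i : ℝ)| ≤ (N + 1) * ‖x - T i‖) :
    ∑ i ∈ Finset.univ.erase j, decay N (x - T i) ≤ 1 / (3 * c ^ 2) + 1 / (δ * (N + 1)) := by
  have hterm : ∀ i ∈ Finset.univ.erase j, decay N (x - T i)
      ≤ 1 / (π * c) ^ 2 * (1 / (n i : ℝ) ^ 2) + 1 / ((N : ℝ) + 1) ^ 2 := by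
    intro i hi
    have hij := Finset.ne_of_mem_erase hi
    have hn0 : 0 < |(n i : ℝ)| := abs_pos.mpr (by exact_mod_cast hn.ne_zero i hij)
    rw [decay, ← sq_abs (n i : ℝ), one_div_mul_one_div, ← mul_pow, mul_assoc, mul_assoc]
    have := hx i hij
    gcongr
  have hinj : Set.InjOn n (Finset.univ.erase j : Finset ι) :=
    hn.injOn.mono fun i hi => Finset.ne_of_mem_erase (Finset.mem_coe.mp hi)
  refine (Finset.sum_le_sum hterm).trans ?_
  rw [Finset.sum_add_distrib, ← Finset.mul_sum, Finset.sum_const, nsmul_eq_mul]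
  refine add_le_add ?_ ?_
  · calc _ ≤ 1 / (π * c) ^ 2 * (π ^ 2 / 3) := by gcongr; exact sum_one_div_sq_le hinj
      _ = _ := by field_simp
  · calc _ ≤ (N + 1) / δ * (1 / ((N : ℝ) + 1) ^ 2) := by
          gcongr
          exact (hn.card_erase_le hN hδ).trans (by gcongr; linarith)
      _ = _ := by field_simp

lemma IsRanking.sum_norm_fejerKernel_le (hn : IsRanking T (δ / N) j n) (hN : 128 ≤ N)
    (hδ : 0 < δ) (hc : 0 < c) (hx : ∀ i ≠ j, c * |(n i : ℝ)| ≤ (N + 1) * ‖x - T i‖) {Z Q : ℝ}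
    (hZ : 0 ≤ Z) (hcZ : 1 / (9.869 * c ^ 2) + 0.0001 ≤ Z ^ 2)
    (hcQ : 1 / (3 * c ^ 2) + 1 / (129 * δ) ≤ Q) (m : ℕ) :
    ∑ i ∈ Finset.univ.erase j, ‖fejerKernel N m (x - T i)‖ ≤ Q * fejerDecayPoly Z m := by
  have : (129 : ℝ) ≤ N + 1 := by exact_mod_cast Nat.succ_le_succ hN
  have hsum : ∑ i ∈ Finset.univ.erase j, decay N (x - T i) ≤ Q := by
    refine (hn.sum_decay_le (by omega) hδ hc hx).trans (le_trans ?_ hcQ)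
    rw [mul_comm δ]
    gcongr
  refine le_trans ?_ (mul_le_mul_of_nonneg_right hsum (fejerDecayPoly_nonneg hZ m))
  rw [Finset.sum_mul]
  refine Finset.sum_le_sum fun i hi => ?_
  have hij := Finset.ne_of_mem_erase hi
  have hrank : (1 : ℝ) ≤ |(n i : ℝ)| := by exact_mod_cast Int.one_le_abs (hn.ne_zero i hij)
  have hdist : c ≤ (N + 1) * ‖x - T i‖ := (le_mul_of_one_le_right hc.le hrank).trans (hx i hij)
  have hne : x - T i ≠ 0 := norm_pos_iff.mp (by nlinarith [norm_nonneg (x - T i)])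
  exact norm_fejerKernel_le_decay N m hne hZ ((decay_le hN hc hdist).trans hcZ)

lemma sum_norm_fejerKernel_le_of_near (hN : 128 ≤ N) (hδ : 0 < δ)
    (hT : ∀ i j, i ≠ j → δ / N ≤ ‖T i - T j‖) (hc : 0 < c)
    (hx : (N + 1) * ‖x - T j‖ ≤ δ - c) {Z Q : ℝ} (hZ : 0 ≤ Z)
    (hcZ : 1 / (9.869 * c ^ 2) + 0.0001 ≤ Z ^ 2)
    (hcQ : 1 / (3 * c ^ 2) + 1 / (129 * δ) ≤ Q) (m : ℕ) :
    ∑ i ∈ Finset.univ.erase j, ‖fejerKernel N m (x - T i)‖ ≤ Q * fejerDecayPoly Z m := by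
  obtain ⟨n, hn⟩ := exists_isRanking (div_pos hδ (by exact_mod_cast (by omega : 0 < N))) hT j
  refine hn.sum_norm_fejerKernel_le hN hδ hc (fun i hi => ?_) hZ hcZ hcQ m
  have hrank : (1 : ℝ) ≤ |(n i : ℝ)| := by exact_mod_cast Int.one_le_abs (hn.ne_zero i hi)
  have hdist : 0 ≤ (N + 1) * ‖x - T j‖ := by positivity
  nlinarith [hn.mul_abs_le (x := x) (by omega) i]

lemma sum_norm_fejerKernel_le_of_nearest (hN : 128 ≤ N) (hδ : 0 < δ)
    (hT : ∀ i j, i ≠ j → δ / N ≤ ‖T i - T j‖) (hx : ∀ i, ‖x - T j‖ ≤ ‖x - T i‖) {Z Q : ℝ}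
    (hZ : 0 ≤ Z) (hcZ : 1 / (9.869 * (δ / 2) ^ 2) + 0.0001 ≤ Z ^ 2)
    (hcQ : 1 / (3 * (δ / 2) ^ 2) + 1 / (129 * δ) ≤ Q) (m : ℕ) :
    ∑ i ∈ Finset.univ.erase j, ‖fejerKernel N m (x - T i)‖ ≤ Q * fejerDecayPoly Z m := by
  obtain ⟨n, hn⟩ := exists_isRanking (div_pos hδ (by exact_mod_cast (by omega : 0 < N))) hT j
  refine hn.sum_norm_fejerKernel_le hN hδ (by positivity) (fun i _ => ?_) hZ hcZ hcQ m
  have hnearest : ((N : ℝ) + 1) * ‖x - T j‖ ≤ (N + 1) * ‖x - T i‖ := by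
    gcongr
    exact hx i
  linarith [hn.mul_abs_le (x := x) (by omega) i]

end RowSums

/-! ### Hermite interpolation -/

section Taylor

variable {E : Type*} [NormedAddCommGroup E] [NormedSpace ℝ E] {f f' f'' : ℝ → E} {C r t : ℝ}

lemma norm_le_of_norm_second_deriv_le_of_nonneg (hf : ∀ t, HasDerivAt f (f' t) t)
    (hf' : ∀ t, HasDerivAt f' (f'' t) t) (h0 : f 0 = 0) (h0' : f' 0 = 0) (ht : 0 ≤ t)
    (hC : ∀ u ∈ Set.Ico 0 t, ‖f'' u‖ ≤ C) : ‖f t‖ ≤ C / 2 * t ^ 2 := by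
  have hderiv : ∀ u ∈ Set.Ico 0 t, ‖f' u‖ ≤ C * u := fun u hu => by
    refine image_norm_le_of_norm_deriv_right_le_deriv_boundary (f' := f'') (B := fun u => C * u)
      (B' := fun _ => C) (fun u _ => (hf' u).continuousAt.continuousWithinAt)
      (fun u _ => (hf' u).hasDerivWithinAt) (by rw [h0', norm_zero, mul_zero]) (fun u => ?_)
      (fun v hv => hC v ⟨hv.1, hv.2.trans hu.2⟩) ⟨hu.1, le_rfl⟩
    simpa only [mul_one] using (hasDerivAt_id' u).const_mul C
  refine image_norm_le_of_norm_deriv_right_le_deriv_boundary (f' := f')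
    (B := fun u => C / 2 * u ^ 2) (B' := fun u => C * u)
    (fun u _ => (hf u).continuousAt.continuousWithinAt) (fun u _ => (hf u).hasDerivWithinAt)
    (by simp [h0]) (fun u => ?_) hderiv ⟨ht, le_rfl⟩
  convert! (hasDerivAt_pow 2 u).const_mul (C / 2) using 1
  ring

lemma norm_le_of_norm_second_deriv_le (hf : ∀ t, HasDerivAt f (f' t) t)
    (hf' : ∀ t, HasDerivAt f' (f'' t) t) (h0 : f 0 = 0) (h0' : f' 0 = 0)
    (hC : ∀ u, |u| ≤ r → ‖f'' u‖ ≤ C) (ht : |t| ≤ r) : ‖f t‖ ≤ C / 2 * t ^ 2 := by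
  rcases le_total 0 t with hpos | hneg
  · refine norm_le_of_norm_second_deriv_le_of_nonneg hf hf' h0 h0' hpos fun u hu => hC u ?_
    rw [abs_of_nonneg hu.1]
    exact hu.2.le.trans ((le_abs_self t).trans ht)
  · have hreflect {g g' : ℝ → E} (hg : ∀ t, HasDerivAt g (g' t) t) (t : ℝ) :
        HasDerivAt (fun t => g (-t)) (-g' (-t)) t := by
      simpa only [Function.comp_def, neg_one_smul] using (hg (-t)).scomp t (hasDerivAt_neg t)
    have h := norm_le_of_norm_second_deriv_le_of_nonneg (t := -t) (C := C) (hreflect hf)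
      (fun t => (hreflect hf' t).neg) (by rw [neg_zero, h0]) (by rw [neg_zero, h0', neg_zero])
      (neg_nonneg.mpr hneg) fun u hu => ?_
    · rwa [neg_neg, neg_sq] at h
    · rw [neg_neg]
      refine hC _ ?_
      rw [abs_neg, abs_of_nonneg hu.1]
      exact hu.2.le.trans ((neg_le_abs t).trans ht)

end Taylor

lemma norm_sum_mul_add_mul_le {ι R : Type*} [Fintype ι] [SeminormedRing R] (S : Finset ι)
    (α β κ κ' : ι → R) : ‖∑ i ∈ S, (α i * κ i + β i * κ' i)‖
      ≤ ‖α‖ * ∑ i ∈ S, ‖κ i‖ + ‖β‖ * ∑ i ∈ S, ‖κ' i‖ := by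
  rw [Finset.mul_sum, Finset.mul_sum, ← Finset.sum_add_distrib]
  refine norm_sum_le_of_le _ fun i _ => (norm_add_le _ _).trans ?_
  exact add_le_add
    ((norm_mul_le _ _).trans (mul_le_mul_of_nonneg_right (norm_le_pi_norm α i) (norm_nonneg _)))
    ((norm_mul_le _ _).trans (mul_le_mul_of_nonneg_right (norm_le_pi_norm β i) (norm_nonneg _)))

/-- The `n`-th derivative, along `dilate N`, of the combination of translates of the Fejér kernel
with coefficients `α` and of translates of its derivative with coefficients `β`. -/
noncomputable def fejerInterp {ι : Type*} [Fintype ι] (N : ℕ) (T : ι → UnitAddCircle)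
    (α β : ι → ℂ) (n : ℕ) (x : UnitAddCircle) : ℂ :=
  ∑ i, (α i * fejerKernel N n (x - T i) + β i * fejerKernel N (n + 1) (x - T i))

/-- The coefficients `α`, `β` define a Fejér combination which takes the value `w j` at `T j` and
is stationary there, for every `j`. -/
structure IsHermiteInterpolant {ι : Type*} [Fintype ι] (N : ℕ) (T : ι → UnitAddCircle)
    (w α β : ι → ℂ) : Prop where
  value_eq : ∀ j, fejerInterp N T α β 0 (T j) = w j
  deriv_eq_zero : ∀ j, fejerInterp N T α β 1 (T j) = 0

section Interpolation

variable {ι : Type*} [Fintype ι] {N : ℕ} {T : ι → UnitAddCircle} {w α β : ι → ℂ}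

lemma hasDerivAt_fejerInterp_add_dilate (n : ℕ) (x : UnitAddCircle) (u : ℝ) :
    HasDerivAt (fun u => fejerInterp N T α β n (x + dilate N u))
      (fejerInterp N T α β (n + 1) (x + dilate N u)) u := by
  refine HasDerivAt.fun_sum fun i _ => ?_
  simp only [add_sub_right_comm x]
  exact ((hasDerivAt_fejerKernel_add_dilate N n (x - T i) u).const_mul (α i)).add
    ((hasDerivAt_fejerKernel_add_dilate N (n + 1) (x - T i) u).const_mul (β i))

lemma fejerInterp_add (α' β' : ι → ℂ) (n : ℕ) (x : UnitAddCircle) :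
    fejerInterp N T (α + α') (β + β') n x
      = fejerInterp N T α β n x + fejerInterp N T α' β' n x := by
  simp only [fejerInterp, Pi.add_apply, ← Finset.sum_add_distrib]
  exact Finset.sum_congr rfl fun i _ => by ring

lemma fejerInterp_smul (c : ℂ) (n : ℕ) (x : UnitAddCircle) :
    fejerInterp N T (c • α) (c • β) n x = c * fejerInterp N T α β n x := by
  simp only [fejerInterp, Pi.smul_apply, smul_eq_mul, Finset.mul_sum]
  exact Finset.sum_congr rfl fun i _ => by ring

lemma exists_trigPoly_eq_fejerInterp (N : ℕ) (T : ι → UnitAddCircle) (α β : ι → ℂ) :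
    ∃ p : Freq N → ℂ, ∀ x, trigPoly p x = fejerInterp N T α β 0 x := by
  refine ⟨fun k => ∑ i, (fejerCoeff N k : ℂ) * fourier (k : ℤ) (-T i)
    * (α i + β i * (2 * Complex.I * (k : ℤ) / (N + 1))), fun x => ?_⟩
  have hfourier (k : ℤ) (i : ι) : fourier k (x - T i) = fourier k (-T i) * fourier k x := by
    rw [sub_eq_neg_add]
    simp [fourier_apply, smul_add, AddCircle.toCircle_add]
  simp only [trigPoly_apply, fejerInterp, fejerKernel, Finset.mul_sum, ← Finset.sum_add_distrib,
    Finset.sum_mul]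
  rw [Finset.sum_comm]
  refine Finset.sum_congr rfl fun i _ => ?_
  rw [← Finset.sum_coe_sort (Finset.Icc (-(N : ℤ)) N)]
  refine Finset.sum_congr rfl fun k _ => ?_
  rw [hfourier]
  ring

lemma norm_fejerInterp_sub_le [DecidableEq ι] (j : ι) (n : ℕ) (x : UnitAddCircle) :
    ‖fejerInterp N T α β n x
        - (α j * fejerKernel N n (x - T j) + β j * fejerKernel N (n + 1) (x - T j))‖
      ≤ ‖α‖ * ∑ i ∈ Finset.univ.erase j, ‖fejerKernel N n (x - T i)‖
        + ‖β‖ * ∑ i ∈ Finset.univ.erase j, ‖fejerKernel N (n + 1) (x - T i)‖ := by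
  rw [fejerInterp, ← Finset.add_sum_erase _ _ (Finset.mem_univ j), add_sub_cancel_left]
  exact norm_sum_mul_add_mul_le _ _ _ _ _

variable (hN : 128 ≤ N) (hT : ∀ i j, i ≠ j → 2.5 / N ≤ ‖T i - T j‖)

include hN hT

lemma sum_norm_fejerKernel_sub_le [DecidableEq ι] (j : ι) (m : ℕ) :
    ∑ i ∈ Finset.univ.erase j, ‖fejerKernel N m (T j - T i)‖
      ≤ 0.05655 * fejerDecayPoly 0.128 m := by
  refine sum_norm_fejerKernel_le_of_near hN (by norm_num) hT (c := 2.5) (by norm_num) ?_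
    (by norm_num) (by norm_num) (by norm_num) m
  rw [sub_self, sub_self, norm_zero, mul_zero]

namespace IsHermiteInterpolant

variable (h : IsHermiteInterpolant N T w α β)

include h

lemma norm_coeff_sub_le_add (j : ι) : ‖α j - w j‖ ≤ 0.05655 * ‖α‖ + 0.0711 * ‖β‖ := by
  classical
  have hle := norm_fejerInterp_sub_le (N := N) (T := T) (α := α) (β := β) j 0 (T j)
  have h0 := sum_norm_fejerKernel_sub_le hN hT j 0
  have h1 := sum_norm_fejerKernel_sub_le hN hT j 1
  rw [h.value_eq, sub_self, fejerKernel_zero_apply_zero, fejerKernel_one_apply_zero, mul_one,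
    mul_zero, add_zero, norm_sub_rev] at hle
  rw [fejerDecayPoly_zero, mul_one] at h0
  rw [fejerDecayPoly_one] at h1
  calc _ ≤ _ := hle
    _ ≤ ‖α‖ * 0.05655 + ‖β‖ * 0.0711 := by
        gcongr
        exact h1.trans (by norm_num)
    _ = _ := by ring

lemma norm_deriv_coeff_le_add (j : ι) : 0.6666 * ‖β j‖ ≤ 0.0711 * ‖α‖ + 0.1532 * ‖β‖ := by
  classical
  have hle := norm_fejerInterp_sub_le (N := N) (T := T) (α := α) (β := β) j 1 (T j)
  have h1 := sum_norm_fejerKernel_sub_le hN hT j 1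
  have h2 := sum_norm_fejerKernel_sub_le hN hT j 2
  have hm := le_fejerMoment_two hN
  rw [h.deriv_eq_zero, sub_self, fejerKernel_one_apply_zero, fejerKernel_two_apply_zero, mul_zero,
    zero_add, zero_sub, mul_neg, neg_neg, norm_mul, Complex.norm_real,
    Real.norm_of_nonneg (le_trans (by norm_num) hm)] at hle
  rw [fejerDecayPoly_one] at h1
  rw [fejerDecayPoly_two] at h2
  calc _ ≤ ‖β j‖ * fejerMoment N 2 := by rw [mul_comm]; gcongr
    _ ≤ _ := hle
    _ ≤ ‖α‖ * 0.0711 + ‖β‖ * 0.1532 := by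
        gcongr
        · exact h1.trans (by norm_num)
        · exact h2.trans (by norm_num)
    _ = _ := by ring

lemma norm_deriv_coeff_le_norm_coeff : ‖β‖ ≤ 0.1385 * ‖α‖ := by
  have hβ : ‖β‖ ≤ (0.0711 * ‖α‖ + 0.1532 * ‖β‖) / 0.6666 :=
    (pi_norm_le_iff_of_nonneg (by positivity)).mpr fun j => by
      rw [le_div_iff₀' (by norm_num)]
      exact h.norm_deriv_coeff_le_add hN hT j
  rw [le_div_iff₀' (by norm_num)] at hβ
  linarith [norm_nonneg α]

lemma norm_coeff_le : ‖α‖ ≤ 1.072 * ‖w‖ := by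
  have hα : ‖α‖ ≤ ‖w‖ + (0.05655 * ‖α‖ + 0.0711 * ‖β‖) :=
    (pi_norm_le_iff_of_nonneg (by positivity)).mpr fun j => by
      rw [← add_sub_cancel (w j) (α j)]
      exact (norm_add_le _ _).trans
        (add_le_add (norm_le_pi_norm w j) (h.norm_coeff_sub_le_add hN hT j))
  linarith [h.norm_deriv_coeff_le_norm_coeff hN hT, norm_nonneg w]

lemma norm_deriv_coeff_le : ‖β‖ ≤ 0.149 * ‖w‖ := by
  linarith [h.norm_deriv_coeff_le_norm_coeff hN hT, h.norm_coeff_le hN hT, norm_nonneg w]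

lemma norm_coeff_sub_le (j : ι) : ‖α j - w j‖ ≤ 0.072 * ‖w‖ := by
  linarith [h.norm_coeff_sub_le_add hN hT j, h.norm_coeff_le hN hT, h.norm_deriv_coeff_le hN hT,
    norm_nonneg w]

end IsHermiteInterpolant

lemma exists_isHermiteInterpolant (w : ι → ℂ) : ∃ α β, IsHermiteInterpolant N T w α β := by
  let L : ((ι → ℂ) × (ι → ℂ)) →ₗ[ℂ] ((ι → ℂ) × (ι → ℂ)) :=
    { toFun := fun p => (fun j => fejerInterp N T p.1 p.2 0 (T j),
        fun j => fejerInterp N T p.1 p.2 1 (T j))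
      map_add' := fun p q => Prod.ext (funext fun _ => fejerInterp_add _ _ _ _)
        (funext fun _ => fejerInterp_add _ _ _ _)
      map_smul' := fun c p => Prod.ext (funext fun _ => fejerInterp_smul _ _ _)
        (funext fun _ => fejerInterp_smul _ _ _) }
  have hinj : Function.Injective L := by
    refine (injective_iff_map_eq_zero L).mpr fun ⟨α, β⟩ h => ?_
    have hzero : IsHermiteInterpolant N T 0 α β :=
      ⟨congrFun (congrArg Prod.fst h), congrFun (congrArg Prod.snd h)⟩
    have hα := hzero.norm_coeff_le hN hT
    have hβ := hzero.norm_deriv_coeff_le hN hT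
    rw [norm_zero, mul_zero, norm_le_zero_iff] at hα hβ
    exact Prod.ext hα hβ
  obtain ⟨⟨α, β⟩, h⟩ := LinearMap.surjective_of_injective hinj (w, 0)
  exact ⟨α, β, congrFun (congrArg Prod.fst h), congrFun (congrArg Prod.snd h)⟩

namespace IsHermiteInterpolant

variable (h : IsHermiteInterpolant N T w α β) {x : UnitAddCircle} {j : ι}

include h

lemma norm_second_deriv_sub_le (hx : (N + 1) * ‖x - T j‖ ≤ 0.4) :
    ‖fejerInterp N T α β 2 x - w j * fejerKernel N 2 (x - T j)‖ ≤ 0.494 * ‖w‖ := by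
  classical
  have hsum (m : ℕ) : ∑ i ∈ Finset.univ.erase j, ‖fejerKernel N m (x - T i)‖
      ≤ 0.0788 * fejerDecayPoly 0.1522 m :=
    sum_norm_fejerKernel_le_of_near hN (by norm_num) hT (c := 2.1) (by norm_num)
      (hx.trans (by norm_num)) (by norm_num) (by norm_num) (by norm_num) m
  have h2 := hsum 2
  have h3 := hsum 3
  rw [fejerDecayPoly_two] at h2
  rw [fejerDecayPoly_three] at h3
  have hK2 := (norm_fejerKernel_le N 2 (x - T j)).trans (fejerMoment_two_le N)
  have hK3 := (norm_fejerKernel_le N 3 (x - T j)).trans (fejerMoment_three_le N)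
  have hα := h.norm_coeff_le hN hT
  have hβ := h.norm_deriv_coeff_le hN hT
  have hother : ‖fejerInterp N T α β 2 x
      - (α j * fejerKernel N 2 (x - T j) + β j * fejerKernel N 3 (x - T j))‖
        ≤ 1.072 * ‖w‖ * 0.2275 + 0.149 * ‖w‖ * 0.5538 :=
    (norm_fejerInterp_sub_le j 2 x).trans (by
      gcongr
      · exact h2.trans (by norm_num)
      · exact h3.trans (by norm_num))
  have hself : ‖(α j - w j) * fejerKernel N 2 (x - T j) + β j * fejerKernel N 3 (x - T j)‖
      ≤ 0.072 * ‖w‖ * (2 / 3) + 0.149 * ‖w‖ * (4 / 5) := by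
    refine (norm_add_le _ _).trans ?_
    rw [norm_mul, norm_mul]
    gcongr
    · exact h.norm_coeff_sub_le hN hT j
    · exact (norm_le_pi_norm β j).trans hβ
  calc _ = ‖(fejerInterp N T α β 2 x
          - (α j * fejerKernel N 2 (x - T j) + β j * fejerKernel N 3 (x - T j)))
        + ((α j - w j) * fejerKernel N 2 (x - T j) + β j * fejerKernel N 3 (x - T j))‖ := by
        congr 1
        ring
    _ ≤ _ := (norm_add_le _ _).trans (add_le_add hother hself)
    _ ≤ _ := by linarith [norm_nonneg w]

lemma norm_sub_le (hx : (N + 1) * ‖x - T j‖ ≤ 0.4) :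
    ‖fejerInterp N T α β 0 x - w j * fejerKernel N 0 (x - T j)‖
      ≤ 0.247 * ‖w‖ * (π * (N + 1) * ‖x - T j‖) ^ 2 := by
  obtain ⟨u, hu, habs⟩ := exists_dilate_eq N (x - T j)
  have hderiv (n : ℕ) (v : ℝ) : HasDerivAt
      (fun v => fejerInterp N T α β n (T j + dilate N v) - w j * fejerKernel N n (dilate N v))
      (fejerInterp N T α β (n + 1) (T j + dilate N v) - w j * fejerKernel N (n + 1) (dilate N v))
      v :=
    (hasDerivAt_fejerInterp_add_dilate n (T j) v).sub
      ((hasDerivAt_fejerKernel_dilate N n v).const_mul (w j))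
  have htaylor := norm_le_of_norm_second_deriv_le (C := 0.494 * ‖w‖) (r := π * 0.4) (t := u)
    (hderiv 0) (hderiv 1)
    (by rw [dilate_zero, add_zero, h.value_eq, fejerKernel_zero_apply_zero, mul_one, sub_self])
    (by rw [dilate_zero, add_zero, h.deriv_eq_zero, fejerKernel_one_apply_zero, mul_zero, sub_self])
    (fun v hv => by
      have hnear := h.norm_second_deriv_sub_le hN hT (x := T j + dilate N v) (j := j)
      rw [add_sub_cancel_left] at hnear
      refine hnear (le_of_mul_le_mul_left ?_ Real.pi_pos)
      rw [← mul_assoc]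
      exact (norm_dilate_le N v).trans hv)
    (by rw [habs, mul_assoc]; gcongr)
  rw [hu, add_sub_cancel, ← sq_abs u, habs] at htaylor
  exact htaylor.trans_eq (by ring)

lemma norm_le_of_near (hx : (N + 1) * ‖x - T j‖ ≤ 0.4) :
    ‖fejerInterp N T α β 0 x‖
      ≤ ‖w j‖ - (0.263 * ‖w j‖ - 0.247 * ‖w‖) * (π * (N + 1) * ‖x - T j‖) ^ 2 := by
  have hq : (π * (N + 1) * ‖x - T j‖) ^ 2 ≤ 1.58 := by
    calc _ ≤ (3.1416 * 0.4 : ℝ) ^ 2 := by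
          rw [mul_assoc]
          gcongr
          exact Real.pi_lt_d4.le
      _ ≤ _ := by norm_num
  calc _ = ‖w j * fejerKernel N 0 (x - T j)
        + (fejerInterp N T α β 0 x - w j * fejerKernel N 0 (x - T j))‖ := by
        rw [add_sub_cancel]
    _ ≤ ‖w j‖ * (1 - 0.263 * (π * (N + 1) * ‖x - T j‖) ^ 2)
        + 0.247 * ‖w‖ * (π * (N + 1) * ‖x - T j‖) ^ 2 := by
        refine (norm_add_le _ _).trans (add_le_add ?_ (h.norm_sub_le hN hT hx))
        rw [norm_mul]
        gcongr
        exact norm_fejerKernel_zero_le hN hq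
    _ = _ := by ring

lemma norm_le_of_sum_le [DecidableEq ι] {X Y z : ℝ} (hz : ‖fejerKernel N 0 (x - T j)‖ ≤ z)
    (hX : ∑ i ∈ Finset.univ.erase j, ‖fejerKernel N 0 (x - T i)‖ ≤ X)
    (hY : ∑ i ∈ Finset.univ.erase j, ‖fejerKernel N 1 (x - T i)‖ ≤ Y) :
    ‖fejerInterp N T α β 0 x‖ ≤ 1.072 * ‖w‖ * (z + X) + 0.149 * ‖w‖ * (2 / 3 + Y) := by
  have hK1 := (norm_fejerKernel_le N 1 (x - T j)).trans (fejerMoment_one_le N)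
  refine (norm_sum_mul_add_mul_le Finset.univ α β _ _).trans ?_
  rw [← Finset.add_sum_erase _ _ (Finset.mem_univ j),
    ← Finset.add_sum_erase _ _ (Finset.mem_univ j)]
  gcongr
  · exact h.norm_coeff_le hN hT
  · exact h.norm_deriv_coeff_le hN hT

lemma norm_le_of_far (hx : ∀ j, 0.4 ≤ (N + 1) * ‖x - T j‖) :
    ‖fejerInterp N T α β 0 x‖ ≤ 0.9 * ‖w‖ := by
  classical
  rcases isEmpty_or_nonempty ι with hι | hι
  · rw [fejerInterp, Finset.univ_eq_empty, Finset.sum_empty, norm_zero]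
    positivity
  obtain ⟨j, hj⟩ := Finite.exists_min fun i => ‖x - T i‖
  rcases le_total ((N + 1) * ‖x - T j‖) 0.5 with hle | hge
  · have hsum := sum_norm_fejerKernel_le_of_near hN (by norm_num) hT (c := 2) (Z := 0.16)
      (Q := 0.0866) (by norm_num) (hle.trans (by norm_num)) (by norm_num) (by norm_num)
      (by norm_num)
    have hK := norm_fejerKernel_zero_le_of_le hN (by norm_num) (hx j)
    refine (h.norm_le_of_sum_le hN hT hK (hsum 0) (hsum 1)).trans ?_
    rw [fejerDecayPoly_zero, fejerDecayPoly_one]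
    linarith [norm_nonneg w]
  · have hsum := sum_norm_fejerKernel_le_of_nearest hN (by norm_num) hT hj (Z := 0.255)
      (Q := 0.2166) (by norm_num) (by norm_num) (by norm_num)
    have hK := norm_fejerKernel_zero_le_of_le hN (by norm_num) hge
    refine (h.norm_le_of_sum_le hN hT hK (hsum 0) (hsum 1)).trans ?_
    rw [fejerDecayPoly_zero, fejerDecayPoly_one]
    linarith [norm_nonneg w]

end IsHermiteInterpolant

end Interpolation

lemma exists_trigPoly_interpolating {ι : Type*} [Finite ι] {N : ℕ} {T : ι → UnitAddCircle}
    {w : ι → ℂ} (hN : 128 ≤ N) (hT : ∀ i j, i ≠ j → 2.5 / N ≤ ‖T i - T j‖)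
    (hw : ∀ i, 1 ≤ ‖w i‖) (hw' : ∀ i, ‖w i‖ ≤ 1.005) :
    ∃ p : Freq N → ℂ, (∀ i, trigPoly p (T i) = w i) ∧ ∀ x,
      (∃ i, ‖trigPoly p x‖ ≤ ‖w i‖ - 0.14 * (N * ‖x - T i‖) ^ 2) ∨ ‖trigPoly p x‖ ≤ 0.91 := by
  have := Fintype.ofFinite ι
  obtain ⟨α, β, h⟩ := exists_isHermiteInterpolant hN hT w
  obtain ⟨p, hp⟩ := exists_trigPoly_eq_fejerInterp N T α β
  have hnorm : ‖w‖ ≤ 1.005 := (pi_norm_le_iff_of_nonneg (by norm_num)).mpr hw'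
  refine ⟨p, fun j => (hp _).trans (h.value_eq j), fun x => ?_⟩
  rw [hp]
  by_cases hx : ∃ j, (N + 1) * ‖x - T j‖ ≤ 0.4
  · obtain ⟨j, hj⟩ := hx
    refine Or.inl ⟨j, (h.norm_le_of_near hN hT hj).trans (sub_le_sub_left ?_ _)⟩
    calc 0.14 * (N * ‖x - T j‖) ^ 2 ≤ 0.0147 * (3.14 * (N + 1) * ‖x - T j‖) ^ 2 := by
          rw [mul_assoc 3.14, mul_pow 3.14, ← mul_assoc]
          gcongr
          · norm_num
          · linarith
      _ ≤ _ := by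
          gcongr
          · linarith [hw j]
          · linarith [hw j]
          · exact Real.pi_gt_d2.le
  · push Not at hx
    exact Or.inr ((h.norm_le_of_far hN hT fun j => (hx j).le).trans (by linarith))

/-! ### Localisation of the spikes -/

section Localisation

variable {fc s : ℕ} {T : Fin s → UnitAddCircle} {lam : ℝ} {a θ : Fin s → ℝ} {ε : Freq fc → ℂ}
  {μ : ComplexMeasure UnitAddCircle}

lemma norm_exp_neg_I_mul (t : ℝ) : ‖Complex.exp (-(Complex.I * (t : ℂ)))‖ = 1 := by
  rw [← mul_neg, mul_comm, ← Complex.ofReal_neg, Complex.norm_exp_ofReal_mul_I]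

variable (hfc : 128 ≤ fc) (hT : ∀ i j, i ≠ j → 2.5 / fc ≤ ‖T i - T j‖) (hlam : 0 < lam)
  (ha : ∀ j, 0 ≤ a j) (hε : ∑ k, ‖ε k‖ ^ 2 ≤ (lam / 4) ^ 2)
  (hμ : IsBlassoSolution fc lam (fun k => fourierSample (spikeTrain a θ T) k + ε k) μ)

include hfc hT hlam ha hε hμ

lemma exists_dualCertificate {c : Fin s → ℝ} {C : ℝ} (hc : ∀ j, 1 ≤ c j) (hcC : ∀ j, c j ≤ C)
    (hC : 1 ≤ C) (hC' : C ≤ 1.005) :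
    ∃ f : C(UnitAddCircle, ℂ),
      tvNorm μ - ∫ x, ‖f x‖ ∂μ.variation
          ≤ ∑ j, a j * (1 - c j) + 1 / 2 * (1 / 4 + C) ^ 2 * lam ∧
        ∀ x, (∃ j, ‖f x‖ ≤ c j - 0.14 * (fc * dist x (T j)) ^ 2) ∨ ‖f x‖ ≤ 0.91 := by
  have hnorm (j : Fin s) : ‖(c j : ℂ) * Complex.exp (-(Complex.I * (θ j : ℂ)))‖ = c j := by
    rw [norm_mul, norm_exp_neg_I_mul, mul_one, Complex.norm_of_nonneg (zero_le_one.trans (hc j))]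
  obtain ⟨p, hpT, hp⟩ := exists_trigPoly_interpolating
    (w := fun j => (c j : ℂ) * Complex.exp (-(Complex.I * (θ j : ℂ)))) hfc hT
    (fun j => (hc j).trans_eq (hnorm j).symm)
    (fun j => (hnorm j).trans_le ((hcC j).trans hC'))
  simp only [hnorm, ← dist_eq_norm] at hp
  have hp_le (x : UnitAddCircle) : ‖trigPoly p x‖ ≤ C := by
    rcases hp x with ⟨j, hj⟩ | hfar
    · linarith [hcC j, sq_nonneg (fc * dist x (T j))]
    · linarith
  have hpair : (∑ k, p k * fourierSample (spikeTrain a θ T) k).re = ∑ j, a j * c j := by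
    rw [sum_mul_fourierSample_spikeTrain, Complex.re_sum]
    refine Finset.sum_congr rfl fun j _ => ?_
    have hphase :
        Complex.exp (-(Complex.I * (θ j : ℂ))) * Complex.exp (Complex.I * (θ j : ℂ)) = 1 := by
      rw [← Complex.exp_add, neg_add_cancel, Complex.exp_zero]
    rw [hpT, mul_mul_mul_comm, hphase, mul_one, ← Complex.ofReal_mul, Complex.ofReal_re, mul_comm]
  refine ⟨trigPoly p, ?_, hp⟩
  have hbregman := tvNorm_sub_integral_norm_le hlam (by norm_num) (δ := 1 / 4)
    (hε.trans_eq (by ring)) hμ (zero_le_one.trans hC) hp_le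
  simp only [mul_sub, mul_one, Finset.sum_sub_distrib]
  linarith [tvNorm_spikeTrain_le ha θ T]

lemma exists_dist_le_of_le_norm_singleton {x : UnitAddCircle} (hx : 9 * lam ≤ ‖μ {x}‖) :
    ∃ j, dist x (T j) ≤ √(lam / (0.179 * ‖μ {x}‖)) * (1 / fc) := by
  have hfc0 : (0 : ℝ) < fc := by exact_mod_cast (by omega : 0 < fc)
  have hm : 0 < ‖μ {x}‖ := by linarith
  obtain ⟨f, hf, hfx⟩ := exists_dualCertificate (c := fun _ => 1) hfc hT hlam ha hε hμ
    (fun _ => le_rfl) (fun _ => le_rfl) le_rfl (by norm_num)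
  have hf_le (y : UnitAddCircle) : ‖f y‖ ≤ 1 := by
    rcases hfx y with ⟨j, hj⟩ | hfar
    · linarith [sq_nonneg (fc * dist y (T j))]
    · linarith
  have hatom : (1 - ‖f x‖) * ‖μ {x}‖ ≤ 25 / 32 * lam := by
    refine (one_sub_norm_mul_norm_singleton_le μ
      f.continuous.aestronglyMeasurable hf_le x).trans (hf.trans_eq ?_)
    simp only [sub_self, mul_zero, Finset.sum_const_zero]
    ring
  rcases hfx x with ⟨j, hj⟩ | hfar
  · refine ⟨j, ?_⟩
    rw [mul_one_div, le_div_iff₀' hfc0]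
    refine Real.le_sqrt_of_sq_le ((le_div_iff₀ (by positivity)).2 ?_)
    have hquad : 0.14 * (fc * dist x (T j)) ^ 2 * ‖μ {x}‖ ≤ (1 - ‖f x‖) * ‖μ {x}‖ := by
      gcongr
      linarith
    linarith
  · have hfar' : 0.09 * ‖μ {x}‖ ≤ (1 - ‖f x‖) * ‖μ {x}‖ := by
      gcongr
      linarith
    linarith

/-- Raising the certificate to `1 + b` at `T j` keeps it at most `1` on the support of `μ`, while
the Bregman bound drops by `a j * b`. -/
lemma mul_le_of_forall_mem_supp {j : Fin s} {b : ℝ} (hb : 0 ≤ b) (hb' : b ≤ 0.005)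
    (hfar : ∀ t ∈ supp μ, b ≤ 0.14 * (fc * dist t (T j)) ^ 2) : a j * b ≤ 0.79 * lam := by
  obtain ⟨f, hf, hfx⟩ := exists_dualCertificate (c := Function.update 1 j (1 + b)) (C := 1 + b)
    hfc hT hlam ha hε hμ
    (le_update_iff.2 ⟨by linarith, fun _ _ => le_rfl⟩)
    (update_le_iff.2 ⟨le_rfl, fun _ _ => le_add_of_nonneg_right hb⟩)
    (by linarith) (by linarith)
  have hf_le : ∀ t ∈ supp μ, ‖f t‖ ≤ 1 := by
    intro t ht
    rcases hfx t with ⟨i, hi⟩ | hsmall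
    · obtain rfl | hij := eq_or_ne i j
      · rw [Function.update_self] at hi
        linarith [hfar t ht]
      · rw [Function.update_of_ne hij, Pi.one_apply] at hi
        linarith [sq_nonneg (fc * dist t (T i))]
    · linarith
  have hnonneg : 0 ≤ tvNorm μ - ∫ x, ‖f x‖ ∂μ.variation :=
    sub_nonneg.2 (integral_norm_le_measureReal_univ hf_le)
  have hsum : ∑ i, a i * (1 - Function.update (1 : Fin s → ℝ) j (1 + b) i) = -(a j * b) := by
    rw [Finset.sum_eq_single_of_mem j (Finset.mem_univ j) fun i _ hij => by
      rw [Function.update_of_ne hij, Pi.one_apply, sub_self, mul_zero], Function.update_self]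
    ring
  have hquad : 1 / 2 * (1 / 4 + (1 + b)) ^ 2 * lam ≤ 1 / 2 * (1 / 4 + (1 + 0.005)) ^ 2 * lam := by
    gcongr
  linarith

lemma exists_mem_supp_dist_le {j : Fin s} (hj : 200 * lam ≤ a j) :
    ∃ t ∈ supp μ, dist (T j) t ≤ √(lam / (0.1678 * a j)) * (1 / fc) := by
  have hfc0 : (0 : ℝ) < fc := by exact_mod_cast (by omega : 0 < fc)
  have haj : 0 < a j := by linarith
  by_contra! hcon
  have hfar : ∀ t ∈ supp μ,
      0.14 * (lam / (0.1678 * a j)) ≤ 0.14 * (fc * dist t (T j)) ^ 2 := fun t ht => by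
    have hlt := hcon t ht
    rw [dist_comm, mul_one_div, div_lt_iff₀' hfc0] at hlt
    linarith [(Real.sqrt_le_iff.1 hlt.le).2]
  have hsmall : 0.14 * (lam / (0.1678 * a j)) ≤ 0.005 := by
    rw [← mul_div_assoc, div_le_iff₀ (by positivity)]
    linarith
  have hmass : a j * (0.14 * (lam / (0.1678 * a j))) = 0.14 / 0.1678 * lam := by
    field_simp
  linarith [mul_le_of_forall_mem_supp hfc hT hlam ha hε hμ (by positivity) hsmall hfar]

end Localisation

lemma le_norm_sub_of_le_einfsep_range {ι E : Type*} [SeminormedAddCommGroup E] {T : ι → E} {r : ℝ}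
    (hT : Function.Injective T) (hr : ENNReal.ofReal r ≤ (Set.range T).einfsep) (i j : ι)
    (hij : i ≠ j) : r ≤ ‖T i - T j‖ := by
  have h := Set.le_edist_of_le_einfsep (Set.mem_range_self i) (Set.mem_range_self j)
    (hT.ne hij) hr
  rwa [edist_dist, ENNReal.ofReal_le_ofReal_iff dist_nonneg, dist_eq_norm] at h

lemma eq_of_dist_le_of_add_lt {ι E : Type*} [SeminormedAddCommGroup E] {T : ι → E} {x : E}
    {r r₁ r₂ : ℝ} (hT : ∀ i j, i ≠ j → r ≤ ‖T i - T j‖) {i j : ι} (hi : dist x (T i) ≤ r₁)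
    (hj : dist x (T j) ≤ r₂) (hr : r₁ + r₂ < r) : i = j := by
  by_contra hij
  have hle := hT i j hij
  rw [← dist_eq_norm] at hle
  linarith [dist_triangle_left (T i) (T j) x]

lemma sqrt_div_mul_one_div_le {l κ m r N : ℝ} (hr : 0 ≤ r) (hN : 0 ≤ N) (hm : 0 < κ * m)
    (h : l ≤ r ^ 2 * (κ * m)) : √(l / (κ * m)) * (1 / N) ≤ r / N := by
  rw [mul_one_div]
  gcongr
  exact Real.sqrt_le_iff.2 ⟨hr, (div_le_iff₀ hm).2 h⟩

end SpikeDetection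

theorem mainTheorem3 {Ω : Type*} [MeasurableSpace Ω] (P : Measure Ω) [IsProbabilityMeasure P]
    (fc : ℕ) (hfc : 128 ≤ fc)
    -- the noise: real and imaginary parts are i.i.d. centered Gaussian, standard deviation `σ`
    (σ : ℝ≥0) (hσ : 0 < σ)
    (ε₁ ε₂ : SpikeDetection.Freq fc → Ω → ℝ)
    (hε₁ : ∀ k, HasLaw (ε₁ k) (gaussianReal 0 (σ ^ 2)) P)
    (hε₂ : ∀ k, HasLaw (ε₂ k) (gaussianReal 0 (σ ^ 2)) P)
    (hindep : iIndepFun (Sum.elim ε₁ ε₂) P)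
    -- the target `∑ⱼ aⱼ exp(i θⱼ) δ_{Tⱼ}`, with support `Set.range T`
    (s : ℕ) (a θ : Fin s → ℝ) (T : Fin s → UnitAddCircle)
    (ha : ∀ j, 0 < a j) (hT : Function.Injective T)
    (hsep : ENNReal.ofReal (2.5 / (fc : ℝ)) ≤ (Set.range T).einfsep)
    -- the tuning parameter
    (lam : ℝ) (hlam : SpikeDetection.lambdaF σ fc ≤ lam) :
    ∃ A : Set Ω, MeasurableSet A ∧
      1 - 2 * Real.exp (-(Real.log fc * (lam ^ 2 / SpikeDetection.lambdaF σ fc ^ 2))) ≤ P.real A ∧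
      ∀ ω ∈ A, ∀ Δhat : ComplexMeasure UnitAddCircle,
        SpikeDetection.IsBlassoSolution fc lam
          (fun k => SpikeDetection.fourierSample (SpikeDetection.spikeTrain a θ T) k
            + ((ε₁ k ω : ℂ) + Complex.I * (ε₂ k ω : ℂ))) Δhat →
        (∀ x : UnitAddCircle, 218 * lam ≤ ‖Δhat {x}‖ →
          ∃ j, dist x (T j) ≤ √(lam / (0.1678 * ‖Δhat {x}‖)) * (1 / (fc : ℝ)) ∧
            dist x (T j) ≤ 0.1649 / (fc : ℝ) ∧
            ∀ i, dist x (T i) ≤ √(lam / (0.1678 * ‖Δhat {x}‖)) * (1 / (fc : ℝ)) → i = j) ∧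
        (∀ j, 218 * lam < a j →
          ∃ t ∈ SpikeDetection.supp Δhat,
            dist (T j) t ≤ √(lam / (0.1678 * (a j - 218 * lam))) * (1 / (fc : ℝ))) := by
  have hlam0 : 0 < lam :=
    (SpikeDetection.lambdaF_pos (by exact_mod_cast hσ) (by omega)).trans_le hlam
  have hfc0 : (0 : ℝ) < fc := by exact_mod_cast (by omega : 0 < fc)
  have ha' (j : Fin s) : 0 ≤ a j := (ha j).le
  have hsep' := SpikeDetection.le_norm_sub_of_le_einfsep_range hT hsep
  obtain ⟨A, hA, hPA, hnoise⟩ :=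
    SpikeDetection.exists_noise_event P hfc hσ hε₁ hε₂ hindep hlam
  refine ⟨A, hA, hPA, fun ω hω Δhat hΔ => ⟨fun x hx => ?_, fun j hj => ?_⟩⟩
  · obtain ⟨j, hj⟩ := SpikeDetection.exists_dist_le_of_le_norm_singleton hfc hsep' hlam0 ha'
      (hnoise ω hω) hΔ (x := x) (by linarith)
    have hm : 0 < ‖Δhat {x}‖ := by linarith
    have hj' : dist x (T j) ≤ 0.1649 / fc := hj.trans <|
      SpikeDetection.sqrt_div_mul_one_div_le (by norm_num) hfc0.le (by positivity) (by linarith)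
    have hrad : √(lam / (0.1678 * ‖Δhat {x}‖)) * (1 / (fc : ℝ)) ≤ 2 / fc :=
      SpikeDetection.sqrt_div_mul_one_div_le (by norm_num) hfc0.le (by positivity) (by linarith)
    refine ⟨j, hj.trans (by gcongr; norm_num), hj', fun i hi => ?_⟩
    refine SpikeDetection.eq_of_dist_le_of_add_lt hsep' (hi.trans hrad) hj' ?_
    rw [← add_div]
    gcongr
    norm_num
  · obtain ⟨t, ht, htj⟩ := SpikeDetection.exists_mem_supp_dist_le hfc hsep' hlam0 ha'
      (hnoise ω hω) hΔ (j := j) (by linarith)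
    refine ⟨t, ht, htj.trans ?_⟩
    gcongr
    linarith
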